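/- Let $n\ge 4$, and let $\mathcal H$ be the Sobolev space $\mathring W^n_2[0;1]$ of all (real- or complex-valued) functions $f$ on $[0;1]$ whose derivatives up to order $n-1$ are absolutely continuous, with $f^{(n)}\in L_2[0;1]$ and $f^{(j)}(0)=f^{(j)}(1)=0$ for $j=0,\dots,n-1$, with the norm $\|f\|_{\mathcal H}=\bigl(\int_0^1|f^{(n)}(x)|^2\,dx\bigr)^{1/2}$. For $a\in[0;1]$ put $$A_{n,3}(a)=\sup\{|f^{(3)}(a)|:\ f\in\mathcal H,\ \|f\|_{\mathcal H}\le 1\},\qquad \Lambda_{n,3}=\sup_{a\in[0;1]}A_{n,3}(a).$$ These suprema are finite, and the following holds. 1. For all $a\in[0;1]$, with $t=a^2-a$, $$A^2_{n,3}(a)=\frac{-t^{2n-7}}{((n-2)!)^2(2n-7)}\Bigl(4(2n-1)(2n-3)^2(2n-7)t^3+12(n-1)(n-2)(2n-3)(2n-7)t^2+3(n-2)^2(2n-3)(2n-7)t+(n-2)^2(n-3)^2\Bigr).$$ 2. Let $$t_{1}=\frac{-(n-2)(2n-3)-\sqrt{3(n-2)(2n-3)}}{2(2n-1)(2n-3)},\qquad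 t_{2}=\frac{-(n-2)(2n-3)+\sqrt{3(n-2)(2n-3)}}{2(2n-1)(2n-3)},\qquad t_3=-\frac{n-3}{2(2n-3)},$$ and $a_i^\pm=\frac12\pm\frac12\sqrt{1+4t_i}$. Then $-\frac14<t_1<t_3<t_2<0$. The function $A^2_{n,3}$ is differentiable on $(0;1)$, and its critical points in $(0;1)$ are exactly $\frac12$ and $a_i^\pm$, $i=1,2,3$; the points $\frac12$ and $a_3^\pm$ are local minima, and $a_1^\pm$, $a_2^\pm$ are local maxima. 3. The global maximum of $A^2_{n,3}$ on $[0;1]$ is attained at $a_1^+$ and $a_1^-$, and at no other point, and $$\Lambda^2_{n,3}=\left(\frac{(n-2)(2n-3)+\sqrt{3(n-2)(2n-3)}}{(2n-1)(2n-3)}\right)^{2n-7}\cdot\frac{3(n-2)\left(3(n-2)(2n-5)-\sqrt3\,(2n-7)\sqrt{(n-2)(2n-3)}\right)}{4^{n-3}((n-2)!)^2(2n-1)^2(2n-7)}.$$ -/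

import Mathlib

open MeasureTheory Set

noncomputable section

namespace SobolevEmbedding

/-- The `j`-th derivative of `f` on the interval `[0, 1]` (one-sided at the end points). -/
def der {𝕜 : Type*} [RCLike 𝕜] (j : ℕ) (f : ℝ → 𝕜) (x : ℝ) : 𝕜 :=
  iteratedDerivWithin j f (Icc (0 : ℝ) 1) x

/-- Membership in the Sobolev space `W̊ⁿ₂[0, 1]`: the derivatives of `f` up to order `n - 1` exist
and are absolutely continuous on `[0, 1]`, `f⁽ⁿ⁾` (which exists almost everywhere) is in `L²[0, 1]`,
and `f⁽ʲ⁾(0) = f⁽ʲ⁾(1) = 0` for `j = 0, …, n - 1`. -/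
structure MemW0 {𝕜 : Type*} [RCLike 𝕜] (n : ℕ) (f : ℝ → 𝕜) : Prop where
  differentiableOn : ∀ j : ℕ, j + 1 < n → DifferentiableOn ℝ (der j f) (Icc (0 : ℝ) 1)
  absolutelyContinuous : ∀ j : ℕ, j < n → AbsolutelyContinuousOnInterval (der j f) 0 1
  memLp : MemLp (der n f) 2 (volume.restrict (Icc (0 : ℝ) 1))
  left_zero : ∀ j : ℕ, j < n → der j f 0 = 0
  right_zero : ∀ j : ℕ, j < n → der j f 1 = 0

/-- The norm `(∫₀¹ |f⁽ⁿ⁾(x)|² dx)^{1/2}` of `W̊ⁿ₂[0, 1]`. -/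
def normW0 {𝕜 : Type*} [RCLike 𝕜] (n : ℕ) (f : ℝ → 𝕜) : ℝ :=
  Real.sqrt (∫ x in (0 : ℝ)..1, ‖der n f x‖ ^ 2)

/-- The values `|f⁽ᵏ⁾(a)|` for `f` in the closed unit ball of `W̊ⁿ₂[0, 1]`. -/
def unitBallValues (𝕜 : Type*) [RCLike 𝕜] (n k : ℕ) (a : ℝ) : Set ℝ :=
  {r : ℝ | ∃ f : ℝ → 𝕜, MemW0 n f ∧ normW0 n f ≤ 1 ∧ r = ‖der k f a‖}

/-- `A_{n,k}(a) = sup {|f⁽ᵏ⁾(a)| : ‖f‖ ≤ 1}`. -/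
def A (𝕜 : Type*) [RCLike 𝕜] (n k : ℕ) (a : ℝ) : ℝ :=
  sSup (unitBallValues 𝕜 n k a)

/-- The exact embedding constant `Λ_{n,k} = sup_{a ∈ [0, 1]} A_{n,k}(a)`. -/
def Lam (𝕜 : Type*) [RCLike 𝕜] (n k : ℕ) : ℝ :=
  sSup (A 𝕜 n k '' Icc (0 : ℝ) 1)

def t₁ (n : ℕ) : ℝ :=
  (-(((n : ℝ) - 2) * (2 * n - 3)) - Real.sqrt (3 * ((n : ℝ) - 2) * (2 * n - 3))) /
    (2 * (2 * (n : ℝ) - 1) * (2 * n - 3))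

def t₂ (n : ℕ) : ℝ :=
  (-(((n : ℝ) - 2) * (2 * n - 3)) + Real.sqrt (3 * ((n : ℝ) - 2) * (2 * n - 3))) /
    (2 * (2 * (n : ℝ) - 1) * (2 * n - 3))

def t₃ (n : ℕ) : ℝ :=
  -(((n : ℝ) - 3) / (2 * (2 * (n : ℝ) - 3)))

/-- The roots `a^± = 1/2 ± √(1 + 4t)/2` of `a² - a = t`. -/
def aPlus (t : ℝ) : ℝ := 1 / 2 + Real.sqrt (1 + 4 * t) / 2

def aMinus (t : ℝ) : ℝ := 1 / 2 - Real.sqrt (1 + 4 * t) / 2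

/-- The polynomial expression for `A²_{n,3}` in the variable `t = a² - a`. -/
def formula3 (n : ℕ) (t : ℝ) : ℝ :=
  -t ^ (2 * n - 7) / (((n - 2).factorial : ℝ) ^ 2 * (2 * (n : ℝ) - 7)) *
    (4 * (2 * (n : ℝ) - 1) * (2 * n - 3) ^ 2 * (2 * n - 7) * t ^ 3
      + 12 * ((n : ℝ) - 1) * (n - 2) * (2 * n - 3) * (2 * n - 7) * t ^ 2
      + 3 * ((n : ℝ) - 2) ^ 2 * (2 * n - 3) * (2 * n - 7) * t
      + ((n : ℝ) - 2) ^ 2 * (n - 3) ^ 2)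

/-- The closed form of `Λ²_{n,3}`. -/
def const3 (n : ℕ) : ℝ :=
  ((((n : ℝ) - 2) * (2 * n - 3) + Real.sqrt (3 * ((n : ℝ) - 2) * (2 * n - 3))) /
      ((2 * (n : ℝ) - 1) * (2 * n - 3))) ^ (2 * n - 7) *
    (3 * ((n : ℝ) - 2) *
        (3 * ((n : ℝ) - 2) * (2 * n - 5)
          - Real.sqrt 3 * (2 * (n : ℝ) - 7) * Real.sqrt (((n : ℝ) - 2) * (2 * n - 3))) /
      (4 ^ (n - 3) * ((n - 2).factorial : ℝ) ^ 2 * (2 * (n : ℝ) - 1) ^ 2 * (2 * (n : ℝ) - 7)))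

end SobolevEmbedding

end

/-! ### Repeated integration and Cauchy's formula. -/

noncomputable section

namespace SobolevEmbedding

/-! Put F = f⁽ⁿ⁾. The conditions at 0 make f⁽ᵏ⁾ the (n − k)-fold integral of F, so by Cauchy's
formula f⁽ᵏ⁾(a) = ∫₀¹ T F, where T is the truncated power (a − x)₊ˡ/l! and l = n − k − 1. The
conditions at 1 say that F is orthogonal to the polynomials of degree less than n
(`moment_eq_zero`). Hence A_{n,k}(a) is the L² distance from T to these polynomials: Cauchy–Schwarz
gives the upper bound, and the n-fold integral of the normalised residual attains it
(`isGreatest_unitBallValues`).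

Expand T in the Legendre polynomials P_j of [0, 1]. Its inner products with them are iterated
primitives of P_j evaluated at a. When the squared distance is differentiated in a, the three-term
relation makes the sum telescope (`sum_primitive_mul`), and all that survives is minus the product
of the l-fold primitives of Pₙ and Pₙ₋₁ (`hasDerivAt_distSq`). For k = 3, Rodrigues' formula turns
these into a fourth and a third derivative of powers of a² − a. With t = a² − a, they are a power of
t times a quadratic in t, and a power of t times 2a − 1 times a linear factor in t. The derivative
thus appears already factored: comparing derivatives, with both sides zero at a = 0, yields the
closed form (`distSq_eq_formula3`), and the factors give the critical points.

As a function of t on [−1/4, 0] the closed form rises to t₁, falls to t₃, rises to t₂ and falls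
again. So only the peaks t₁ and t₂ compete; `formula3_t₂_lt` decides between them, by Bernoulli's
inequality in `pow_mul_lt_pow_mul`. -/

/-- The Volterra operator `F ↦ ∫₀ˣ F`. -/
def volterra (F : ℝ → ℝ) (x : ℝ) : ℝ := ∫ s in (0 : ℝ)..x, F s

/-- Integrability on every bounded interval. -/
def LocInt (F : ℝ → ℝ) : Prop := ∀ a b, IntervalIntegrable F volume a b

theorem locInt_of_continuous {F : ℝ → ℝ} (hF : Continuous F) : LocInt F :=
  fun a b => hF.intervalIntegrable a b

theorem LocInt.continuous_volterra {F : ℝ → ℝ} (hF : LocInt F) : Continuous (volterra F) :=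
  intervalIntegral.continuous_primitive hF 0

theorem volterra_zero (F : ℝ → ℝ) : volterra F 0 = 0 := by simp [volterra]

theorem hasDerivAt_volterra {F : ℝ → ℝ} (hF : Continuous F) (x : ℝ) :
    HasDerivAt (volterra F) (F x) x :=
  (hF.integral_hasStrictDerivAt 0 x).hasDerivAt

theorem LocInt.iterate_volterra {F : ℝ → ℝ} (hF : LocInt F) (i : ℕ) : LocInt (volterra^[i] F) := by
  induction i with
  | zero => exact hF
  | succ i ih =>
    rw [Function.iterate_succ_apply']
    exact locInt_of_continuous ih.continuous_volterra

theorem LocInt.continuous_iterate_volterra {F : ℝ → ℝ} (hF : LocInt F) (i : ℕ) :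
    Continuous (volterra^[i + 1] F) := by
  rw [Function.iterate_succ_apply']
  exact (hF.iterate_volterra i).continuous_volterra

theorem LocInt.ae_deriv_volterra {F : ℝ → ℝ} (hF : LocInt F) :
    ∀ᵐ x, HasDerivAt (volterra F) (F x) x := by
  have hloc : LocallyIntegrable F volume := by
    intro x
    refine ⟨Icc (x - 1) (x + 1), Icc_mem_nhds (by linarith) (by linarith), ?_⟩
    have := (hF (x - 1) (x + 1)).1
    rwa [integrableOn_Icc_iff_integrableOn_Ioc]
  filter_upwards [_root_.LocallyIntegrable.ae_hasDerivAt_integral hloc] with x hx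
  exact hx 0

/-- Integration by parts. The boundary terms vanish because the power is zero at `a` and the
primitive is zero at `0`. Since `F` is merely integrable, its primitive is differentiable only
almost everywhere, so the version for absolutely continuous functions is needed. -/
theorem LocInt.integral_pow_succ_mul {F : ℝ → ℝ} (hF : LocInt F) (i : ℕ) (a : ℝ) :
    ∫ x in (0 : ℝ)..a, (a - x) ^ (i + 1) / ((i + 1).factorial : ℝ) * F x =
      ∫ x in (0 : ℝ)..a, (a - x) ^ i / (i.factorial : ℝ) * volterra F x := by
  have hf : AbsolutelyContinuousOnInterval
      (fun x : ℝ => (a - x) ^ (i + 1) / ((i + 1).factorial : ℝ)) 0 a :=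
    ContDiffOn.absolutelyContinuousOnInterval (by fun_prop)
  have hg : AbsolutelyContinuousOnInterval (volterra F) 0 a :=
    (hF 0 a).absolutelyContinuousOnInterval_intervalIntegral (by simp)
  have key := hf.integral_mul_deriv_eq_deriv_mul hg
  have h1 : ∫ x in (0 : ℝ)..a, (a - x) ^ (i + 1) / ((i + 1).factorial : ℝ) * F x =
      ∫ x in (0 : ℝ)..a, (a - x) ^ (i + 1) / ((i + 1).factorial : ℝ) * deriv (volterra F) x := by
    apply intervalIntegral.integral_congr_ae
    filter_upwards [hF.ae_deriv_volterra] with x hx _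
    rw [hx.deriv]
  have h2 : ∀ x, deriv (fun x : ℝ => (a - x) ^ (i + 1) / ((i + 1).factorial : ℝ)) x =
      -((a - x) ^ i / (i.factorial : ℝ)) := by
    intro x
    have h3 : HasDerivAt (fun x : ℝ => (a - x) ^ (i + 1) / ((i + 1).factorial : ℝ))
        ((((i + 1 : ℕ) : ℝ) * (a - x) ^ i * (-1)) / ((i + 1).factorial : ℝ)) x := by
      simpa using (((hasDerivAt_id x).const_sub a).pow (i + 1)).div_const ((i + 1).factorial : ℝ)
    rw [h3.deriv, Nat.factorial_succ]
    push_cast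
    have : (i.factorial : ℝ) ≠ 0 := by positivity
    field_simp
  rw [h1, key]
  simp [h2, volterra_zero]

/-- Cauchy's formula for repeated integration. -/
theorem LocInt.integral_pow_mul {F : ℝ → ℝ} (hF : LocInt F) (i : ℕ) (a : ℝ) :
    ∫ x in (0 : ℝ)..a, (a - x) ^ i / (i.factorial : ℝ) * F x = volterra^[i + 1] F a := by
  induction i generalizing F with
  | zero => simp [volterra]
  | succ i ih =>
    rw [hF.integral_pow_succ_mul, ih (locInt_of_continuous hF.continuous_volterra),
      ← Function.iterate_succ_apply]

end SobolevEmbedding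

end

/-! ### Primitives of polynomials and Legendre polynomials of [0, 1]. -/

noncomputable section

namespace SobolevEmbedding

open Polynomial

/-- The antiderivative of a polynomial that vanishes at `0`. -/
def primitive : ℝ[X] →ₗ[ℝ] ℝ[X] :=
  Polynomial.lsum fun k => (monomial (k + 1)).comp (LinearMap.mulLeft ℝ (((k : ℝ) + 1)⁻¹))

theorem primitive_monomial (k : ℕ) (c : ℝ) :
    primitive (monomial k c) = monomial (k + 1) (((k : ℝ) + 1)⁻¹ * c) := by
  simp [primitive, Polynomial.lsum_apply]

theorem derivative_primitive (p : ℝ[X]) : derivative (primitive p) = p := by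
  induction p using Polynomial.induction_on' with
  | add p q hp hq => simp [hp, hq]
  | monomial k c =>
    have : (k : ℝ) + 1 ≠ 0 := by positivity
    rw [primitive_monomial, derivative_monomial]
    congr 1
    push_cast
    field_simp

theorem eval_zero_primitive (p : ℝ[X]) : (primitive p).eval 0 = 0 := by
  induction p using Polynomial.induction_on' with
  | add p q hp hq => simp [hp, hq]
  | monomial k c => simp [primitive_monomial, eval_monomial]

theorem eq_primitive {p q : ℝ[X]} (hd : derivative q = p) (h0 : q.eval 0 = 0) :
    q = primitive p := by
  have h1 : derivative (q - primitive p) = 0 := by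
    rw [derivative_sub, derivative_primitive, hd, sub_self]
  have h2 := Polynomial.derivative_eq_zero.mp h1
  rw [Polynomial.natDegree_eq_zero] at h2
  obtain ⟨c, hc⟩ := h2
  have h3 : c = 0 := by
    have := congrArg (Polynomial.eval 0) hc
    simpa [h0, eval_zero_primitive] using this
  rw [h3, C_0] at hc
  exact sub_eq_zero.mp hc.symm

theorem integral_eval_derivative (q : ℝ[X]) (a b : ℝ) :
    ∫ x in a..b, (derivative q).eval x = q.eval b - q.eval a :=
  intervalIntegral.integral_eq_sub_of_hasDerivAt (fun x _ => q.hasDerivAt x)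
    ((derivative q).continuous.intervalIntegrable a b)

theorem volterra_eval (p : ℝ[X]) :
    volterra (fun x => p.eval x) = fun x => (primitive p).eval x := by
  funext x
  have := integral_eval_derivative (primitive p) 0 x
  rw [derivative_primitive, eval_zero_primitive, sub_zero] at this
  exact this

theorem iterate_volterra_eval (i : ℕ) (p : ℝ[X]) :
    volterra^[i] (fun x => p.eval x) = fun x => (primitive^[i] p).eval x := by
  induction i generalizing p with
  | zero => rfl
  | succ i ih => rw [Function.iterate_succ_apply, volterra_eval, ih, Function.iterate_succ_apply]

theorem integral_pow_mul_eval (i : ℕ) (p : ℝ[X]) (a : ℝ) :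
    ∫ x in (0 : ℝ)..a, (a - x) ^ i / (i.factorial : ℝ) * p.eval x =
      (primitive^[i + 1] p).eval a := by
  rw [(locInt_of_continuous p.continuous).integral_pow_mul, iterate_volterra_eval]

theorem primitive_iterate_one (i : ℕ) :
    primitive^[i] (1 : ℝ[X]) = C ((i.factorial : ℝ)⁻¹) * X ^ i := by
  induction i with
  | zero => simp
  | succ i ih =>
    rw [Function.iterate_succ_apply', ih, C_mul_X_pow_eq_monomial, C_mul_X_pow_eq_monomial,
      primitive_monomial, Nat.factorial_succ]
    congr 1
    push_cast
    rw [mul_inv]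

/-- The Legendre polynomials of the interval `[0, 1]`, by Rodrigues' formula. -/
def legendre (j : ℕ) : ℝ[X] :=
  (j.factorial : ℝ)⁻¹ • derivative^[j] ((X ^ 2 - X) ^ j)

theorem eval_iterate_derivative_rodrigues {i j : ℕ} (h : i < j) {x : ℝ} (hx : x ^ 2 - x = 0) :
    (derivative^[i] ((X ^ 2 - X : ℝ[X]) ^ j)).eval x = 0 := by
  obtain ⟨q, hq⟩ := Polynomial.pow_sub_dvd_iterate_derivative_pow (X ^ 2 - X : ℝ[X]) j i
  have : j - i ≠ 0 := by omega
  rw [hq]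
  simp [hx, this]

/-- Each derivative removed from Rodrigues' formula is the primitive normalised at 0, because fewer
than j derivatives of (x² − x)ʲ still vanish there. -/
theorem primitive_iterate_legendre {i j : ℕ} (h : i ≤ j) :
    primitive^[i] (legendre j) =
      (j.factorial : ℝ)⁻¹ • derivative^[j - i] ((X ^ 2 - X) ^ j) := by
  induction i with
  | zero => rfl
  | succ i ih =>
    rw [Function.iterate_succ_apply', ih (by omega)]
    symm
    apply eq_primitive
    · rw [derivative_smul, ← Function.iterate_succ_apply' derivative]
      congr 3
      omega
    · rw [eval_smul, eval_iterate_derivative_rodrigues (by omega) (by norm_num), smul_zero]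

/-- With w = x² − x one has w'² = 4w + 1 and w'' = 2, so two derivatives of a power of w are again a
combination of powers of w. This is the source of both the three-term relation and the explicit
higher derivatives. -/
theorem derivative_derivative_rodrigues (j : ℕ) :
    derivative (derivative ((X ^ 2 - X : ℝ[X]) ^ (j + 2))) =
    ((j : ℝ) + 2) • (((j : ℝ) + 1) • (X ^ 2 - X) ^ j +
      (2 * (2 * ((j : ℝ) + 1) + 1)) • (X ^ 2 - X) ^ (j + 1)) := by
  simp only [derivative_pow, derivative_mul, derivative_sub, derivative_X, derivative_C,
    Nat.add_sub_cancel, show j + 2 - 1 = j + 1 by omega, smul_eq_C_mul, map_add, map_mul]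
  simp [show (C 2 : ℝ[X]) = 2 from rfl]
  ring

theorem derivative_sq_rodrigues (j : ℕ) :
    (((j + 2).factorial : ℝ)⁻¹) • derivative (derivative ((X ^ 2 - X : ℝ[X]) ^ (j + 2))) =
      ((j.factorial : ℝ)⁻¹) • (X ^ 2 - X) ^ j +
        (2 * (2 * ((j + 1 : ℕ) : ℝ) + 1)) •
          (((j + 1).factorial : ℝ)⁻¹ • (X ^ 2 - X) ^ (j + 1)) := by
  rw [derivative_derivative_rodrigues, Nat.factorial_succ, Nat.factorial_succ]
  have : (j.factorial : ℝ) ≠ 0 := by positivity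
  have : (j : ℝ) + 1 ≠ 0 := by positivity
  have : (j : ℝ) + 2 ≠ 0 := by positivity
  simp only [smul_add, smul_smul]
  push_cast
  congr 2
  · field_simp
    ring
  · field_simp
    ring

/-- The three-term relation for the primitives of the Legendre polynomials. -/
theorem legendre_add_two (j : ℕ) :
    legendre (j + 2) = legendre j +
      (2 * (2 * ((j + 1 : ℕ) : ℝ) + 1)) • primitive (legendre (j + 1)) := by
  have h := congrArg (derivative^[j]) (derivative_sq_rodrigues j)
  have h2 := primitive_iterate_legendre (i := 1) (j := j + 1) (by omega)
  rw [Function.iterate_one, Nat.add_sub_cancel] at h2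
  rw [h2]
  simp only [iterate_map_add, iterate_derivative_smul, ← Function.iterate_succ_apply] at h
  exact h

theorem legendre_zero : legendre 0 = 1 := by simp [legendre]

theorem legendre_one : legendre 1 = 2 * X - 1 := by
  simp [legendre, one_add_one_eq_two, show (C 2 : ℝ[X]) = 2 from rfl]

/-- By `legendre_add_two`, 2(2j + 1) times the primitive of P_j is P_{j+1} − P_{j−1}, so each
summand is a difference of consecutive products and the sum telescopes. -/
theorem sum_primitive_mul (l n : ℕ) :
    ∑ j ∈ Finset.range (n + 1), (2 * (2 * (j : ℝ) + 1)) •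
        (primitive^[l + 1] (legendre j) * primitive^[l] (legendre j)) =
      primitive^[l] (legendre (n + 1)) * primitive^[l] (legendre n) +
        primitive^[l] 1 * primitive^[l] 1 := by
  induction n with
  | zero =>
    -- At the bottom of the telescope −1 plays the role of P₋₁; this produces the extra square on
    -- the right-hand side.
    have h : (2 : ℝ) • primitive (1 : ℝ[X]) = legendre 1 + 1 := by
      rw [← map_smul]
      symm
      apply eq_primitive
      · simp [legendre_one, smul_eq_C_mul, show (C 2 : ℝ[X]) = 2 from rfl]
      · simp [legendre_one]
    have h2 := congrArg (primitive^[l]) h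
    rw [iterate_map_add, ← Module.End.coe_pow, map_smul, Module.End.coe_pow,
      ← Function.iterate_succ_apply] at h2
    simp only [zero_add, Finset.sum_range_one, legendre_zero, Nat.cast_zero, mul_zero, mul_one]
    rw [← smul_mul_assoc, h2]
    ring
  | succ n ih =>
    rw [Finset.sum_range_succ, ih]
    have h2 := congrArg (primitive^[l]) (legendre_add_two n)
    rw [iterate_map_add, ← Module.End.coe_pow, map_smul, Module.End.coe_pow,
      ← Function.iterate_succ_apply] at h2
    rw [← smul_mul_assoc, h2]
    ring

theorem natDegree_legendre (j : ℕ) : (legendre j).natDegree = j := by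
  have h1 : ∀ (i : ℕ) (p : ℝ[X]), (derivative^[i] p).natDegree = p.natDegree - i := by
    intro i
    induction i with
    | zero => simp
    | succ i ih =>
      intro p
      rw [Function.iterate_succ_apply', natDegree_derivative, ih]
      omega
  have h2 : (X ^ 2 - X : ℝ[X]).natDegree = 2 := by compute_degree!
  have : (j.factorial : ℝ)⁻¹ ≠ 0 := by positivity
  rw [legendre, natDegree_smul _ this, h1, natDegree_pow, h2]
  omega

theorem eval_one_legendre (j : ℕ) : (legendre j).eval 1 = 1 := by
  induction j using Nat.twoStepInduction with
  | zero => simp [legendre_zero]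
  | one => norm_num [legendre_one]
  | more j ih _ =>
    have h2 := primitive_iterate_legendre (i := 1) (j := j + 1) (by omega)
    rw [Function.iterate_one, Nat.add_sub_cancel] at h2
    rw [legendre_add_two, h2]
    simp [ih, eval_iterate_derivative_rodrigues (show j < j + 1 by omega)
      (show (1 : ℝ) ^ 2 - 1 = 0 by norm_num)]

theorem eval_zero_legendre (j : ℕ) : (legendre j).eval 0 = (-1) ^ j := by
  induction j using Nat.twoStepInduction with
  | zero => simp [legendre_zero]
  | one => norm_num [legendre_one]
  | more j ih _ =>
    rw [legendre_add_two]
    simp [ih, eval_zero_primitive, pow_succ]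

end SobolevEmbedding

end

/-! ### Moments, orthogonality and best approximation of truncated powers. -/

noncomputable section

namespace SobolevEmbedding

open Polynomial

theorem LocInt.mul_continuous {F g : ℝ → ℝ} (hF : LocInt F) (hg : Continuous g) :
    LocInt fun x => g x * F x :=
  fun a b => (hF a b).continuousOn_mul hg.continuousOn

theorem LocInt.sub {F G : ℝ → ℝ} (hF : LocInt F) (hG : LocInt G) : LocInt fun x => F x - G x :=
  fun a b => (hF a b).sub (hG a b)

/-- The linear functional `q ↦ ∫₀¹ q F` on polynomials. -/
def moment (F : ℝ → ℝ) (hF : LocInt F) : ℝ[X] →ₗ[ℝ] ℝ where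
  toFun q := ∫ x in (0 : ℝ)..1, q.eval x * F x
  map_add' p q := by
    rw [← intervalIntegral.integral_add (hF.mul_continuous p.continuous 0 1)
      (hF.mul_continuous q.continuous 0 1)]
    simp [add_mul]
  map_smul' c p := by
    rw [RingHom.id_apply, smul_eq_mul, ← intervalIntegral.integral_const_mul]
    simp [mul_assoc]

theorem moment_apply {F : ℝ → ℝ} (hF : LocInt F) (q : ℝ[X]) :
    moment F hF q = ∫ x in (0 : ℝ)..1, q.eval x * F x := rfl

theorem moment_one_sub_pow {F : ℝ → ℝ} (hF : LocInt F) (i : ℕ) :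
    moment F hF ((1 - X) ^ i) = (i.factorial : ℝ) * volterra^[i + 1] F 1 := by
  have : (i.factorial : ℝ) ≠ 0 := by positivity
  rw [← hF.integral_pow_mul, ← intervalIntegral.integral_const_mul, moment_apply]
  congr 1
  funext x
  simp
  field_simp

/-- Expand q in powers of x − 1: by Cauchy's formula the moments of these powers are, up to
constants, the iterated integrals of F at 1. -/
theorem moment_eq_zero {F : ℝ → ℝ} (hF : LocInt F) {n : ℕ}
    (h : ∀ i < n, volterra^[i + 1] F 1 = 0) {q : ℝ[X]} (hq : q.degree < n) :
    moment F hF q = 0 := by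
  rw [← Polynomial.sum_taylor_eq q 1, Polynomial.sum_def, map_sum]
  refine Finset.sum_eq_zero fun i hi => ?_
  have hi' : i < n := by
    have h1 : (i : WithBot ℕ) ≤ (taylor 1 q).degree := le_degree_of_mem_supp i hi
    rw [Polynomial.degree_taylor] at h1
    exact_mod_cast h1.trans_lt hq
  have h2 : (X - C 1 : ℝ[X]) ^ i = ((-1 : ℝ) ^ i) • (1 - X) ^ i := by
    rw [smul_eq_C_mul, C_pow, ← mul_pow]
    congr 1
    simp
  rw [← smul_eq_C_mul, map_smul, h2, map_smul, moment_one_sub_pow, h i hi']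
  simp

theorem integral_mul_legendre_eq_zero {q : ℝ[X]} {j : ℕ} (hq : q.degree < j) :
    ∫ x in (0 : ℝ)..1, q.eval x * (legendre j).eval x = 0 := by
  have hF : LocInt fun x => (legendre j).eval x := locInt_of_continuous (legendre j).continuous
  refine moment_eq_zero hF (fun i hi => ?_) hq
  rw [iterate_volterra_eval, primitive_iterate_legendre hi]
  simp [eval_iterate_derivative_rodrigues (show j - (i + 1) < j by omega)
      (show (1 : ℝ) ^ 2 - 1 = 0 by norm_num)]

theorem legendre_ne_zero (j : ℕ) : legendre j ≠ 0 := by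
  intro h
  have := eval_one_legendre j
  simp [h] at this

theorem degree_legendre (j : ℕ) : (legendre j).degree = j := by
  rw [degree_eq_natDegree (legendre_ne_zero j), natDegree_legendre]

theorem integral_legendre_mul_legendre_of_ne {i j : ℕ} (h : i ≠ j) :
    ∫ x in (0 : ℝ)..1, (legendre i).eval x * (legendre j).eval x = 0 := by
  rcases lt_or_gt_of_ne h with h | h
  · exact integral_mul_legendre_eq_zero (by rw [degree_legendre]; exact_mod_cast h)
  · simp_rw [mul_comm ((legendre i).eval _)]
    exact integral_mul_legendre_eq_zero (by rw [degree_legendre]; exact_mod_cast h)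

theorem degree_derivative_legendre_lt (j : ℕ) : (derivative (legendre j)).degree < j := by
  have := degree_derivative_lt (legendre_ne_zero j)
  rwa [degree_legendre] at this

/-- Integrate the derivative of P_{j+1}P_{j+2}: the end point values give 2. On the other side
P'_{j+1} is orthogonal to P_{j+2}, and P'_{j+2} = P'_j + 2(2j + 3)P_{j+1} leaves only the wanted
square. -/
theorem integral_legendre_sq (j : ℕ) :
    ∫ x in (0 : ℝ)..1, (legendre j).eval x * (legendre j).eval x = (2 * (j : ℝ) + 1)⁻¹ := by
  rcases j with _ | j
  · simp [legendre_zero]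
  have h1 := integral_eval_derivative (legendre (j + 1) * legendre (j + 2)) 0 1
  have hc : ∀ p q : ℝ[X], IntervalIntegrable (fun x => p.eval x * q.eval x) volume 0 1 :=
    fun p q => (p.continuous.mul q.continuous).intervalIntegrable 0 1
  simp only [derivative_mul, eval_add, eval_mul, eval_one_legendre, eval_zero_legendre] at h1
  rw [intervalIntegral.integral_add (hc _ _) (hc _ _), integral_mul_legendre_eq_zero
    ((degree_derivative_legendre_lt (j + 1)).trans (by exact_mod_cast Nat.lt_succ_self _))] at h1
  have h2 : derivative (legendre (j + 2)) = derivative (legendre j) +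
      (2 * (2 * ((j + 1 : ℕ) : ℝ) + 1)) • legendre (j + 1) := by
    rw [legendre_add_two, derivative_add, derivative_smul, derivative_primitive]
  have h3 : (fun x : ℝ => (legendre (j + 1)).eval x * (derivative (legendre (j + 2))).eval x) =
      fun x : ℝ => (derivative (legendre j)).eval x * (legendre (j + 1)).eval x +
        (2 * (2 * ((j + 1 : ℕ) : ℝ) + 1)) *
          ((legendre (j + 1)).eval x * (legendre (j + 1)).eval x) := by
    funext x
    rw [h2, eval_add, eval_smul, smul_eq_mul]
    ring
  rw [h3, intervalIntegral.integral_add (hc _ _) ((hc _ _).const_mul _),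
    intervalIntegral.integral_const_mul, integral_mul_legendre_eq_zero
    ((degree_derivative_legendre_lt j).trans (by exact_mod_cast Nat.lt_succ_self _))] at h1
  have h4 : (2 * ((j + 1 : ℕ) : ℝ) + 1) ≠ 0 := by positivity
  have h5 : (-1 : ℝ) ^ (j + 1) * (-1) ^ (j + 2) = -1 := by
    rw [← pow_add, show j + 1 + (j + 2) = 2 * (j + 1) + 1 by ring, pow_succ, pow_mul]
    norm_num
  rw [h5] at h1
  apply eq_inv_of_mul_eq_one_left
  linarith

theorem moment_eq_zero_of_legendre {F : ℝ → ℝ} (hF : LocInt F) {n : ℕ}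
    (h : ∀ j < n, moment F hF (legendre j) = 0) {q : ℝ[X]} (hq : q.degree < n) :
    moment F hF q = 0 := by
  let S : Polynomial.Sequence ℝ := ⟨legendre, degree_legendre⟩
  have hspan := S.span_degreeLT (m := n) (fun i _ => by
    rw [isUnit_iff_ne_zero, Ne, leadingCoeff_eq_zero]
    exact legendre_ne_zero i)
  have hmem : q ∈ Submodule.span ℝ (S '' Set.Iio n) := by
    rw [hspan]
    exact mem_degreeLT.mpr hq
  have hle : Submodule.span ℝ (S '' Set.Iio n) ≤ LinearMap.ker (moment F hF) := by
    rw [Submodule.span_le]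
    rintro _ ⟨j, hj, rfl⟩
    exact h j hj
  exact hle hmem

/-- The truncated power `(a - x)₊ˡ / l!`. -/
def truncPow (l : ℕ) (a : ℝ) : ℝ → ℝ :=
  indicator {x | x ≤ a} fun x => (a - x) ^ l / (l.factorial : ℝ)

theorem locInt_truncPow (l : ℕ) (a : ℝ) : LocInt (truncPow l a) := by
  intro b c
  have h : Continuous fun x : ℝ => (a - x) ^ l / (l.factorial : ℝ) := by fun_prop
  exact ⟨(h.intervalIntegrable b c).1.indicator measurableSet_Iic,
    (h.intervalIntegrable b c).2.indicator measurableSet_Iic⟩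

theorem LocInt.truncPow_mul {F : ℝ → ℝ} (hF : LocInt F) (l : ℕ) (a : ℝ) :
    LocInt fun x => truncPow l a x * F x := by
  have h : LocInt fun x => (a - x) ^ l / (l.factorial : ℝ) * F x :=
    hF.mul_continuous (by fun_prop)
  have h3 : (fun x => truncPow l a x * F x) = indicator {x | x ≤ a}
      fun x : ℝ => (a - x) ^ l / (l.factorial : ℝ) * F x := by
    funext x
    simp only [truncPow, indicator]
    split_ifs <;> simp
  rw [h3]
  exact fun b c => ⟨(h b c).1.indicator measurableSet_Iic, (h b c).2.indicator measurableSet_Iic⟩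

theorem integral_truncPow_mul (l : ℕ) {a : ℝ} (ha : a ∈ Icc (0 : ℝ) 1) (F : ℝ → ℝ) :
    ∫ x in (0 : ℝ)..1, truncPow l a x * F x =
      ∫ x in (0 : ℝ)..a, (a - x) ^ l / (l.factorial : ℝ) * F x := by
  rw [← intervalIntegral.integral_indicator ha]
  congr 1
  funext x
  simp only [truncPow, indicator]
  split_ifs <;> simp

theorem integral_truncPow_sq (l : ℕ) {a : ℝ} (ha : a ∈ Icc (0 : ℝ) 1) :
    ∫ x in (0 : ℝ)..1, truncPow l a x * truncPow l a x =
      a ^ (2 * l + 1) / ((2 * (l : ℝ) + 1) * (l.factorial : ℝ) ^ 2) := by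
  rw [integral_truncPow_mul l ha]
  have h1 : ∀ x ∈ uIcc 0 a, (a - x) ^ l / (l.factorial : ℝ) * truncPow l a x =
      ((l.factorial : ℝ) ^ 2)⁻¹ * (a - x) ^ (2 * l) := by
    intro x hx
    rw [uIcc_of_le ha.1] at hx
    rw [truncPow, indicator_of_mem (show x ∈ {x | x ≤ a} from hx.2)]
    ring
  rw [intervalIntegral.integral_congr h1, intervalIntegral.integral_const_mul,
    intervalIntegral.integral_comp_sub_left (fun x => x ^ (2 * l)), integral_pow]
  simp
  field_simp

/-- The best `L²[0, 1]` approximation of `truncPow l a` by polynomials of degree less than `n`. -/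
def bestApprox (n l : ℕ) (a : ℝ) : ℝ[X] :=
  ∑ j ∈ Finset.range n, ((2 * (j : ℝ) + 1) * (primitive^[l + 1] (legendre j)).eval a) • legendre j

/-- The error function of the best approximation. -/
def residual (n l : ℕ) (a x : ℝ) : ℝ := truncPow l a x - (bestApprox n l a).eval x

/-- The squared `L²[0, 1]` distance from `truncPow l a` to the polynomials of degree less
than `n`. -/
def distSq (n l : ℕ) (a : ℝ) : ℝ :=
  a ^ (2 * l + 1) / ((2 * (l : ℝ) + 1) * (l.factorial : ℝ) ^ 2) -
    ∑ j ∈ Finset.range n, (2 * (j : ℝ) + 1) * (primitive^[l + 1] (legendre j)).eval a ^ 2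

theorem locInt_eval (p : ℝ[X]) : LocInt fun x => p.eval x := locInt_of_continuous p.continuous

theorem locInt_residual (n l : ℕ) (a : ℝ) : LocInt (residual n l a) :=
  (locInt_truncPow l a).sub (locInt_eval _)

theorem integral_truncPow_mul_eval (l : ℕ) {a : ℝ} (ha : a ∈ Icc (0 : ℝ) 1) (p : ℝ[X]) :
    ∫ x in (0 : ℝ)..1, truncPow l a x * p.eval x = (primitive^[l + 1] p).eval a := by
  rw [integral_truncPow_mul l ha, integral_pow_mul_eval]

theorem integral_bestApprox_mul_legendre (n l : ℕ) (a : ℝ) {j : ℕ} (hj : j < n) :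
    ∫ x in (0 : ℝ)..1, (bestApprox n l a).eval x * (legendre j).eval x =
      (primitive^[l + 1] (legendre j)).eval a := by
  rw [← moment_apply (locInt_eval (legendre j)), bestApprox, map_sum,
    Finset.sum_eq_single_of_mem j (Finset.mem_range.mpr hj)]
  · rw [map_smul, moment_apply, integral_legendre_sq, smul_eq_mul]
    field_simp
  · intro i _ hij
    rw [map_smul, moment_apply, integral_legendre_mul_legendre_of_ne hij, smul_zero]

theorem moment_residual_legendre {n l : ℕ} {a : ℝ} (ha : a ∈ Icc (0 : ℝ) 1) {j : ℕ} (hj : j < n) :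
    moment (residual n l a) (locInt_residual n l a) (legendre j) = 0 := by
  have h1 : ∀ x, (legendre j).eval x * residual n l a x =
      (legendre j).eval x * truncPow l a x -
        (bestApprox n l a).eval x * (legendre j).eval x := by
    intro x
    rw [residual]
    ring
  simp_rw [moment_apply, h1]
  rw [intervalIntegral.integral_sub
    ((locInt_truncPow l a).mul_continuous (legendre j).continuous 0 1)
    ((locInt_eval _).mul_continuous (bestApprox n l a).continuous 0 1),
    integral_bestApprox_mul_legendre n l a hj]
  simp_rw [mul_comm ((legendre j).eval _)]
  rw [integral_truncPow_mul_eval l ha, sub_self]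

theorem degree_bestApprox_lt (n l : ℕ) (a : ℝ) : (bestApprox n l a).degree < n := by
  rw [← mem_degreeLT]
  refine Submodule.sum_mem _ fun j hj => Submodule.smul_mem _ _ ?_
  rw [mem_degreeLT, degree_legendre]
  exact_mod_cast Finset.mem_range.mp hj

theorem integral_truncPow_mul_residual {n l : ℕ} {a : ℝ} (ha : a ∈ Icc (0 : ℝ) 1) :
    ∫ x in (0 : ℝ)..1, truncPow l a x * residual n l a x = distSq n l a := by
  have h1 : ∀ x, truncPow l a x * residual n l a x =
      truncPow l a x * truncPow l a x - (bestApprox n l a).eval x * truncPow l a x := by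
    intro x
    rw [residual]
    ring
  simp_rw [h1]
  rw [intervalIntegral.integral_sub ((locInt_truncPow l a).truncPow_mul l a 0 1)
    ((locInt_truncPow l a).mul_continuous (bestApprox n l a).continuous 0 1),
    integral_truncPow_sq l ha, ← moment_apply (locInt_truncPow l a), bestApprox, map_sum, distSq]
  congr 1
  refine Finset.sum_congr rfl fun j _ => ?_
  rw [map_smul, moment_apply]
  simp_rw [mul_comm ((legendre j).eval _)]
  rw [integral_truncPow_mul_eval l ha, smul_eq_mul]
  ring

theorem integral_residual_sq {n l : ℕ} {a : ℝ} (ha : a ∈ Icc (0 : ℝ) 1) :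
    ∫ x in (0 : ℝ)..1, residual n l a x ^ 2 = distSq n l a := by
  have h1 : ∀ x, residual n l a x ^ 2 = truncPow l a x * residual n l a x -
      (bestApprox n l a).eval x * residual n l a x := by
    intro x
    rw [residual]
    ring
  simp_rw [h1]
  rw [intervalIntegral.integral_sub ((locInt_residual n l a).truncPow_mul l a 0 1)
    ((locInt_residual n l a).mul_continuous (bestApprox n l a).continuous 0 1),
    integral_truncPow_mul_residual ha, ← moment_apply (locInt_residual n l a),
    moment_eq_zero_of_legendre _ (fun j hj => moment_residual_legendre ha hj)
      (degree_bestApprox_lt n l a), sub_zero]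

/-- The residual is orthogonal to every (1 − x)ⁱ with i < n, which is exactly the right-hand
boundary condition for its n-fold integral. This makes the extremal function admissible. -/
theorem iterate_volterra_residual_one {n l : ℕ} {a : ℝ} (ha : a ∈ Icc (0 : ℝ) 1) {i : ℕ}
    (hi : i < n) : volterra^[i + 1] (residual n l a) 1 = 0 := by
  have h1 := moment_eq_zero_of_legendre (locInt_residual n l a)
    (fun j hj => moment_residual_legendre ha hj) (q := (1 - X) ^ i) (by
      have : ((1 - X : ℝ[X]) ^ i).degree ≤ i := by
        compute_degree
        exact le_rfl
      exact this.trans_lt (by exact_mod_cast hi))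
  rw [moment_one_sub_pow] at h1
  exact (mul_eq_zero.mp h1).resolve_left (by positivity)

theorem iterate_volterra_residual_self {n l : ℕ} {a : ℝ} (ha : a ∈ Icc (0 : ℝ) 1) :
    volterra^[l + 1] (residual n l a) a = distSq n l a := by
  rw [← (locInt_residual n l a).integral_pow_mul, ← integral_truncPow_mul l ha,
    integral_truncPow_mul_residual ha]

theorem distSq_nonneg {n l : ℕ} {a : ℝ} (ha : a ∈ Icc (0 : ℝ) 1) : 0 ≤ distSq n l a := by
  rw [← integral_residual_sq ha]
  exact intervalIntegral.integral_nonneg zero_le_one fun x _ => sq_nonneg _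

end SobolevEmbedding

end

/-! ### The extremal problem in the Sobolev space. -/

noncomputable section

namespace SobolevEmbedding

theorem integral_truncPow_mul_eq_volterra {F : ℝ → ℝ} (hF : LocInt F) (l : ℕ) {a : ℝ}
    (ha : a ∈ Icc (0 : ℝ) 1) :
    ∫ x in (0 : ℝ)..1, truncPow l a x * F x = volterra^[l + 1] F a := by
  rw [integral_truncPow_mul l ha, hF.integral_pow_mul]

theorem LocInt.residual_mul {F : ℝ → ℝ} (hF : LocInt F) (n l : ℕ) (a : ℝ) :
    LocInt fun x => residual n l a x * F x := by
  have h := (hF.truncPow_mul l a).sub (hF.mul_continuous (bestApprox n l a).continuous)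
  simpa only [residual, sub_mul] using h

theorem sq_iterate_volterra_le {F : ℝ → ℝ} (hF : LocInt F)
    (hF2 : IntervalIntegrable (fun x => F x ^ 2) volume 0 1) {n l : ℕ} {a : ℝ}
    (ha : a ∈ Icc (0 : ℝ) 1) (h : ∀ i < n, volterra^[i + 1] F 1 = 0) :
    volterra^[l + 1] F a ^ 2 ≤ distSq n l a * ∫ x in (0 : ℝ)..1, F x ^ 2 := by
  have hr := hF.residual_mul n l a
  have hr2 := (locInt_residual n l a).residual_mul n l a
  have h1 : ∫ x in (0 : ℝ)..1, residual n l a x * F x = volterra^[l + 1] F a := by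
    simp_rw [residual, sub_mul]
    rw [intervalIntegral.integral_sub (hF.truncPow_mul l a 0 1)
      (hF.mul_continuous (bestApprox n l a).continuous 0 1),
      integral_truncPow_mul_eq_volterra hF l ha, ← moment_apply hF,
      moment_eq_zero hF h (degree_bestApprox_lt n l a), sub_zero]
  -- Cauchy–Schwarz through the discriminant: the quadratic is ∫(F − t·residual)². The residual may
  -- replace the truncated power because F annihilates the approximating polynomial.
  have h2 : ∀ t : ℝ, 0 ≤ distSq n l a * (t * t) + (-2 * volterra^[l + 1] F a) * t +
      ∫ x in (0 : ℝ)..1, F x ^ 2 := by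
    intro t
    have h3 : 0 ≤ ∫ x in (0 : ℝ)..1, (F x - t * residual n l a x) ^ 2 :=
      intervalIntegral.integral_nonneg zero_le_one fun x _ => sq_nonneg _
    have h4 : ∀ x, (F x - t * residual n l a x) ^ 2 = F x ^ 2 - 2 * t * (residual n l a x * F x) +
        t * t * (residual n l a x * residual n l a x) := by
      intro x
      ring
    simp_rw [h4] at h3
    rw [intervalIntegral.integral_add (hF2.sub ((hr 0 1).const_mul _)) ((hr2 0 1).const_mul _),
      intervalIntegral.integral_sub hF2 ((hr 0 1).const_mul _),
      intervalIntegral.integral_const_mul, intervalIntegral.integral_const_mul, h1] at h3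
    simp_rw [← sq (residual n l a _)] at h3
    rw [integral_residual_sq ha] at h3
    linarith
  have h5 := discrim_le_zero h2
  rw [discrim] at h5
  linarith

section Absolute

variable {E G : Type*} [PseudoMetricSpace E] [PseudoMetricSpace G]

theorem _root_.LipschitzWith.comp_absolutelyContinuousOnInterval {φ : E → G}
    (hφ : LipschitzWith 1 φ) {f : ℝ → E} {a b : ℝ} (hf : AbsolutelyContinuousOnInterval f a b) :
    AbsolutelyContinuousOnInterval (fun x => φ (f x)) a b := by
  rw [absolutelyContinuousOnInterval_iff] at hf ⊢
  intro ε hε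
  obtain ⟨δ, hδ, h⟩ := hf ε hε
  refine ⟨δ, hδ, fun I hI hlen => lt_of_le_of_lt (Finset.sum_le_sum fun i _ => ?_) (h I hI hlen)⟩
  simpa using hφ.dist_le_mul (f (I.2 i).1) (f (I.2 i).2)

end Absolute

variable {𝕜 : Type*} [RCLike 𝕜]

theorem lipschitzWith_of_norm_le {φ : 𝕜 →L[ℝ] ℝ} (hφ : ∀ z, |φ z| ≤ ‖z‖) : LipschitzWith 1 φ := by
  refine LipschitzWith.of_dist_le_mul fun x y => ?_
  rw [NNReal.coe_one, one_mul, dist_eq_norm, dist_eq_norm, ← map_sub]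
  exact hφ _

theorem lipschitzWith_ofReal : LipschitzWith 1 (fun x : ℝ => (x : 𝕜)) := by
  refine LipschitzWith.of_dist_le_mul fun x y => ?_
  rw [NNReal.coe_one, one_mul, dist_eq_norm, dist_eq_norm, ← RCLike.ofReal_sub, RCLike.norm_ofReal,
    Real.norm_eq_abs]

theorem AbsolutelyContinuousOnInterval.ae_differentiableAt_rclike {f : ℝ → 𝕜} {a b : ℝ}
    (hf : AbsolutelyContinuousOnInterval f a b) :
    ∀ᵐ x, x ∈ uIcc a b → DifferentiableAt ℝ f x := by
  have h1 := ((lipschitzWith_of_norm_le (φ := (RCLike.reCLM : 𝕜 →L[ℝ] ℝ))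
    RCLike.abs_re_le_norm).comp_absolutelyContinuousOnInterval hf).ae_differentiableAt
  have h2 := ((lipschitzWith_of_norm_le (φ := (RCLike.imCLM : 𝕜 →L[ℝ] ℝ))
    RCLike.abs_im_le_norm).comp_absolutelyContinuousOnInterval hf).ae_differentiableAt
  filter_upwards [h1, h2] with x hx1 hx2 hx
  have h3 : f = fun x => (RCLike.ofRealCLM (RCLike.reCLM (f x)) : 𝕜) +
      RCLike.ofRealCLM (RCLike.imCLM (f x)) * (RCLike.I : 𝕜) := by
    funext y
    simp [RCLike.re_add_im]
  rw [h3]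
  exact ((RCLike.ofRealCLM : ℝ →L[ℝ] 𝕜).differentiableAt.comp x (hx1 hx)).add
    (((RCLike.ofRealCLM : ℝ →L[ℝ] 𝕜).differentiableAt.comp x (hx2 hx)).mul_const _)

theorem der_succ (j : ℕ) (f : ℝ → 𝕜) (x : ℝ) :
    der (j + 1) f x = derivWithin (der j f) (Icc (0 : ℝ) 1) x := by
  rw [der, iteratedDerivWithin_succ]
  rfl

theorem ae_hasDerivAt_der {f : ℝ → 𝕜} {j : ℕ}
    (hf : AbsolutelyContinuousOnInterval (der j f) 0 1) :
    ∀ᵐ x, x ∈ Ioo (0 : ℝ) 1 → HasDerivAt (der j f) (der (j + 1) f x) x := by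
  filter_upwards [AbsolutelyContinuousOnInterval.ae_differentiableAt_rclike hf] with x hx hx01
  have hd := hx (by rw [uIcc_of_le zero_le_one]; exact Ioo_subset_Icc_self hx01)
  rw [der_succ, derivWithin_of_mem_nhds (Icc_mem_nhds hx01.1 hx01.2)]
  exact hd.hasDerivAt

/-- The fundamental theorem of calculus for the derivatives of a member of `W̊ⁿ₂[0, 1]`, read
through a contractive linear functional. -/
theorem MemW0.integral_der {n : ℕ} {f : ℝ → 𝕜} (hf : MemW0 n f) {φ : 𝕜 →L[ℝ] ℝ}
    (hφ : ∀ z, |φ z| ≤ ‖z‖) {j : ℕ} (hj : j < n) {x : ℝ} (hx : x ∈ Icc (0 : ℝ) 1) :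
    ∫ s in (0 : ℝ)..x, φ (der (j + 1) f s) = φ (der j f x) := by
  have hac := (lipschitzWith_of_norm_le hφ).comp_absolutelyContinuousOnInterval
    (hf.absolutelyContinuous j hj)
  have hac' := hac.mono (c := 0) (d := x) (by
    rw [uIcc_of_le hx.1, uIcc_of_le zero_le_one]
    exact Icc_subset_Icc_right hx.2)
  have h1 := hac'.integral_deriv_eq_sub
  rw [hf.left_zero j hj, map_zero, sub_zero] at h1
  rw [← h1]
  apply intervalIntegral.integral_congr_ae
  -- The ordinary derivative agrees with `der` only inside the interval; the interval of integration
  -- already omits 0, so only 1 has to be discarded.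
  have hne : ∀ᵐ s : ℝ, s ≠ 1 := by simp [ae_iff, measure_singleton]
  filter_upwards [ae_hasDerivAt_der (hf.absolutelyContinuous j hj), hne] with s hs hs1 hsx
  rw [uIoc_of_le hx.1] at hsx
  have hs01 : s ∈ Ioo (0 : ℝ) 1 := ⟨hsx.1, lt_of_le_of_ne (hsx.2.trans hx.2) hs1⟩
  exact ((φ.hasFDerivAt.comp_hasDerivAt s (hs hs01)).deriv).symm

theorem MemW0.norm_der_le {n : ℕ} {f : ℝ → 𝕜} (hf : MemW0 n f) (hnorm : normW0 n f ≤ 1)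
    {k l : ℕ} (hkl : k + l + 1 = n) {a : ℝ} (ha : a ∈ Icc (0 : ℝ) 1) :
    ‖der k f a‖ ≤ √(distSq n l a) := by
  -- A unimodular `c` rotates the value at `a` onto the positive axis, so the real functional z ↦
  -- Re(cz) reduces the complex case to the real one.
  obtain ⟨c, hc, hca⟩ := RCLike.exists_norm_eq_mul_self (der k f a)
  let φ : 𝕜 →L[ℝ] ℝ := (RCLike.reCLM : 𝕜 →L[ℝ] ℝ).comp (ContinuousLinearMap.mul ℝ 𝕜 c)
  have hφ_apply : ∀ z, φ z = RCLike.re (c * z) := fun z => rfl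
  have hφ : ∀ z, |φ z| ≤ ‖z‖ := by
    intro z
    rw [hφ_apply]
    refine (RCLike.abs_re_le_norm _).trans ?_
    rw [norm_mul, hc, one_mul]
  have hmem : MemLp (fun x => φ (der n f x)) 2 (volume.restrict (Icc (0 : ℝ) 1)) :=
    hf.memLp.continuousLinearMap_comp φ
  -- Extension by zero makes the function integrable on the whole line, as `LocInt` requires.
  let F : ℝ → ℝ := indicator (Icc (0 : ℝ) 1) fun x => φ (der n f x)
  have hFint : Integrable F volume := by
    rw [integrable_indicator_iff measurableSet_Icc]
    exact hmem.integrable one_le_two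
  have hF : LocInt F := fun b d => hFint.intervalIntegrable
  have hFeq : ∀ x ∈ Icc (0 : ℝ) 1, F x = φ (der n f x) := fun x hx => indicator_of_mem hx _
  have hV : ∀ i ≤ n, ∀ x ∈ Icc (0 : ℝ) 1, volterra^[i] F x = φ (der (n - i) f x) := by
    intro i
    induction i with
    | zero => exact fun _ => hFeq
    | succ i ih =>
      intro hi x hx
      rw [Function.iterate_succ_apply', volterra, ← hf.integral_der hφ (by omega) hx]
      apply intervalIntegral.integral_congr
      intro s hs
      rw [uIcc_of_le hx.1] at hs
      simp only
      rw [ih (by omega) s ⟨hs.1, hs.2.trans hx.2⟩]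
      congr 3
      omega
  have h1 : ∀ i < n, volterra^[i + 1] F 1 = 0 := by
    intro i hi
    rw [hV (i + 1) hi 1 (by simp), hf.right_zero _ (by omega), map_zero]
  have h2 : volterra^[l + 1] F a = ‖der k f a‖ := by
    rw [hV (l + 1) (by omega) a ha, show n - (l + 1) = k by omega, hφ_apply, ← hca,
      RCLike.ofReal_re]
  have hd2 : IntervalIntegrable (fun x => ‖der n f x‖ ^ 2) volume 0 1 := by
    rw [intervalIntegrable_iff_integrableOn_Icc_of_le zero_le_one]
    exact hf.memLp.integrable_norm_pow two_ne_zero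
  have hF2 : IntervalIntegrable (fun x => F x ^ 2) volume 0 1 := by
    rw [intervalIntegrable_iff_integrableOn_Icc_of_le zero_le_one]
    have h3 : IntegrableOn (fun x => (φ (der n f x)) ^ 2) (Icc (0 : ℝ) 1) :=
      hmem.integrable_sq
    refine h3.congr_fun (fun x hx => ?_) measurableSet_Icc
    simp only
    rw [hFeq x hx]
  have h3 : ∫ x in (0 : ℝ)..1, F x ^ 2 ≤ 1 := by
    have h4 : ∫ x in (0 : ℝ)..1, F x ^ 2 ≤ ∫ x in (0 : ℝ)..1, ‖der n f x‖ ^ 2 := by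
      refine intervalIntegral.integral_mono_on zero_le_one hF2 hd2 fun x hx => ?_
      rw [hFeq x hx, ← sq_abs]
      exact pow_le_pow_left₀ (abs_nonneg _) (hφ _) 2
    refine h4.trans ?_
    simpa using (Real.sqrt_le_iff.mp hnorm).2
  have h4 := sq_iterate_volterra_le (l := l) hF hF2 ha h1
  rw [h2] at h4
  refine Real.le_sqrt_of_sq_le (h4.trans ?_)
  exact mul_le_of_le_one_right (distSq_nonneg ha) h3

theorem iterate_volterra_const_mul (c : ℝ) (F : ℝ → ℝ) (i : ℕ) :
    volterra^[i] (fun x => c * F x) = fun x => c * volterra^[i] F x := by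
  induction i with
  | zero => rfl
  | succ i ih =>
    funext x
    rw [Function.iterate_succ_apply', ih, volterra, intervalIntegral.integral_const_mul,
      Function.iterate_succ_apply']
    rfl

theorem hasDerivAt_iterate_volterra {F : ℝ → ℝ} (hF : LocInt F) (i : ℕ) (x : ℝ) :
    HasDerivAt (volterra^[i + 2] F) (volterra^[i + 1] F x) x := by
  rw [Function.iterate_succ_apply']
  exact hasDerivAt_volterra (hF.continuous_iterate_volterra i) x

theorem hasDerivAt_ofReal_comp {f : ℝ → ℝ} {f' x : ℝ} (hf : HasDerivAt f f' x) :
    HasDerivAt (fun y => (f y : 𝕜)) (f' : 𝕜) x :=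
  (RCLike.ofRealCLM : ℝ →L[ℝ] 𝕜).hasFDerivAt.comp_hasDerivAt x hf

/-- The iterated integral lives on the whole line, so two-sided derivatives exist at 0 and 1 as
well. The restriction j < n keeps at least one integration; the n-th derivative is `F` only almost
everywhere. -/
theorem der_ofReal_iterate_volterra {F : ℝ → ℝ} (hF : LocInt F) {n j : ℕ} (hj : j < n) :
    ∀ x ∈ Icc (0 : ℝ) 1,
      der j (fun x => (volterra^[n] F x : 𝕜)) x = (volterra^[n - j] F x : 𝕜) := by
  induction j with
  | zero =>
    intro x _
    rw [der, iteratedDerivWithin_zero, Nat.sub_zero]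
  | succ j ih =>
    intro x hx
    rw [der_succ, derivWithin_congr (fun y hy => ih (by omega) y hy) (ih (by omega) x hx)]
    have h1 := hasDerivAt_ofReal_comp (𝕜 := 𝕜) (hasDerivAt_iterate_volterra hF (n - (j + 2)) x)
    rw [show n - (j + 2) + 2 = n - j by omega, show n - (j + 2) + 1 = n - (j + 1) by omega] at h1
    exact h1.hasDerivWithinAt.derivWithin (uniqueDiffOn_Icc zero_lt_one x hx)

theorem ae_der_ofReal_iterate_volterra {F : ℝ → ℝ} (hF : LocInt F) {n : ℕ} (hn : 0 < n) :
    ∀ᵐ x, x ∈ Icc (0 : ℝ) 1 → der n (fun x => (volterra^[n] F x : 𝕜)) x = (F x : 𝕜) := by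
  obtain ⟨m, rfl⟩ : ∃ m, n = m + 1 := ⟨n - 1, by omega⟩
  filter_upwards [hF.ae_deriv_volterra] with x hx hx01
  rw [der_succ, derivWithin_congr
    (fun y hy => der_ofReal_iterate_volterra hF (Nat.lt_succ_self m) y hy)
    (der_ofReal_iterate_volterra hF (Nat.lt_succ_self m) x hx01),
    show m.succ - m = 1 by omega, Function.iterate_one]
  exact (hasDerivAt_ofReal_comp (𝕜 := 𝕜) hx).hasDerivWithinAt.derivWithin
    (uniqueDiffOn_Icc zero_lt_one x hx01)

theorem iterate_volterra_succ_zero (F : ℝ → ℝ) (i : ℕ) : volterra^[i + 1] F 0 = 0 := by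
  rw [Function.iterate_succ_apply', volterra_zero]

theorem memW0_iterate_volterra {F : ℝ → ℝ} (hF : LocInt F)
    (hF2 : MemLp F 2 (volume.restrict (Icc (0 : ℝ) 1))) {n : ℕ} (hn : 0 < n)
    (h : ∀ i < n, volterra^[i + 1] F 1 = 0) : MemW0 n (fun x => (volterra^[n] F x : 𝕜)) := by
  have hder := fun j (hj : j < n) => der_ofReal_iterate_volterra (𝕜 := 𝕜) hF hj
  refine ⟨fun j hj => ?_, fun j hj => ?_, ?_, fun j hj => ?_, fun j hj => ?_⟩
  · refine DifferentiableOn.congr (f := fun x => (volterra^[n - j] F x : 𝕜)) ?_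
      (hder j (by omega))
    intro x _
    have h1 := hasDerivAt_ofReal_comp (𝕜 := 𝕜) (hasDerivAt_iterate_volterra hF (n - (j + 2)) x)
    rw [show n - (j + 2) + 2 = n - j by omega] at h1
    exact h1.differentiableAt.differentiableWithinAt
  · have h1 : AbsolutelyContinuousOnInterval (volterra^[n - j] F) 0 1 := by
      rw [show n - j = n - (j + 1) + 1 by omega, Function.iterate_succ_apply']
      exact (hF.iterate_volterra _ 0 1).absolutelyContinuousOnInterval_intervalIntegral (by simp)
    have h2 := (lipschitzWith_ofReal (𝕜 := 𝕜)).comp_absolutelyContinuousOnInterval h1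
    -- Absolute continuity sees only values on [0, 1], where the two functions agree; the definition
    -- is unfolded to transfer it.
    rw [absolutelyContinuousOnInterval_iff] at h2 ⊢
    intro ε hε
    obtain ⟨δ, hδ, h3⟩ := h2 ε hε
    refine ⟨δ, hδ, fun I hI hlen => ?_⟩
    convert h3 I hI hlen using 1
    refine Finset.sum_congr rfl fun i hi => ?_
    have h4 := hI.1 i hi
    rw [uIcc_of_le zero_le_one] at h4
    rw [hder j hj _ h4.1, hder j hj _ h4.2]
  · refine (hF2.ofReal (K := 𝕜)).ae_eq ?_
    rw [Filter.EventuallyEq, ae_restrict_iff' measurableSet_Icc]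
    filter_upwards [ae_der_ofReal_iterate_volterra (𝕜 := 𝕜) hF hn] with x hx hx01
    exact (hx hx01).symm
  · rw [hder j hj 0 (by simp), show n - j = n - (j + 1) + 1 by omega, iterate_volterra_succ_zero,
      RCLike.ofReal_zero]
  · rw [hder j hj 1 (by simp), show n - j = n - (j + 1) + 1 by omega, h _ (by omega),
      RCLike.ofReal_zero]

theorem normW0_iterate_volterra {F : ℝ → ℝ} (hF : LocInt F) {n : ℕ} (hn : 0 < n) :
    normW0 n (fun x => (volterra^[n] F x : 𝕜)) = √(∫ x in (0 : ℝ)..1, F x ^ 2) := by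
  rw [normW0]
  congr 1
  apply intervalIntegral.integral_congr_ae
  filter_upwards [ae_der_ofReal_iterate_volterra (𝕜 := 𝕜) hF hn] with x hx hx01
  rw [uIoc_of_le zero_le_one] at hx01
  rw [hx (Ioc_subset_Icc_self hx01), RCLike.norm_ofReal, sq_abs]

theorem memLp_residual (n l : ℕ) (a : ℝ) :
    MemLp (residual n l a) 2 (volume.restrict (Icc (0 : ℝ) 1)) := by
  have h1 : ∀ g : ℝ → ℝ, Continuous g → MemLp g 2 (volume.restrict (Icc (0 : ℝ) 1)) := by
    intro g hg
    obtain ⟨c, hc⟩ := isCompact_Icc.exists_bound_of_continuousOn (hg.continuousOn (s := Icc 0 1))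
    refine MemLp.of_bound hg.aestronglyMeasurable c ?_
    rw [ae_restrict_iff' measurableSet_Icc]
    exact Filter.Eventually.of_forall hc
  exact ((h1 _ (by fun_prop)).indicator measurableSet_Iic).sub
    (h1 _ (bestApprox n l a).continuous)

theorem isGreatest_unitBallValues {n k l : ℕ} (hkl : k + l + 1 = n) {a : ℝ}
    (ha : a ∈ Icc (0 : ℝ) 1) : IsGreatest (unitBallValues 𝕜 n k a) √(distSq n l a) := by
  refine ⟨?_, ?_⟩
  -- If the distance is zero then `d = 0` and the function is zero, which attains the value 0; no
  -- case distinction is needed.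
  · set d : ℝ := (√(distSq n l a))⁻¹ with hd
    have hn : 0 < n := by omega
    have hF : LocInt fun x => d * residual n l a x :=
      (locInt_residual n l a).mul_continuous continuous_const
    refine ⟨fun x => (volterra^[n] (fun x => d * residual n l a x) x : 𝕜),
      memW0_iterate_volterra hF ((memLp_residual n l a).const_mul d) hn fun i hi => ?_, ?_, ?_⟩
    · rw [iterate_volterra_const_mul]
      simp only
      rw [iterate_volterra_residual_one ha hi, mul_zero]
    · rw [normW0_iterate_volterra hF hn]
      simp_rw [mul_pow]
      rw [intervalIntegral.integral_const_mul, integral_residual_sq ha, Real.sqrt_le_iff, one_pow,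
        hd, inv_pow, Real.sq_sqrt (distSq_nonneg ha)]
      exact ⟨zero_le_one, inv_mul_le_one⟩
    · rw [der_ofReal_iterate_volterra hF (by omega) a ha, show n - k = l + 1 by omega,
        iterate_volterra_const_mul]
      simp only
      rw [iterate_volterra_residual_self ha, RCLike.norm_ofReal, hd, ← div_eq_inv_mul,
        Real.div_sqrt, abs_of_nonneg (Real.sqrt_nonneg _)]
  · rintro _ ⟨f, hf, hnorm, rfl⟩
    exact hf.norm_der_le hnorm hkl ha

theorem A_eq_sqrt {n k l : ℕ} (hkl : k + l + 1 = n) {a : ℝ} (ha : a ∈ Icc (0 : ℝ) 1) :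
    A 𝕜 n k a = √(distSq n l a) :=
  (isGreatest_unitBallValues hkl ha).csSup_eq

theorem A_sq_eq {n k l : ℕ} (hkl : k + l + 1 = n) {a : ℝ} (ha : a ∈ Icc (0 : ℝ) 1) :
    A 𝕜 n k a ^ 2 = distSq n l a := by
  rw [A_eq_sqrt hkl ha, Real.sq_sqrt (distSq_nonneg ha)]

end SobolevEmbedding

end

/-! ### The derivative of the squared distance and its closed form for k = 3. -/

noncomputable section

namespace SobolevEmbedding

open Polynomial

/-- The square left over by the telescoping sum is precisely the derivative of the leading term, so
the two cancel. -/
theorem hasDerivAt_distSq (n l : ℕ) (a : ℝ) :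
    HasDerivAt (distSq (n + 1) l)
      (-((primitive^[l] (legendre (n + 1))).eval a * (primitive^[l] (legendre n)).eval a)) a := by
  have h1 : HasDerivAt (fun a : ℝ => a ^ (2 * l + 1) / ((2 * (l : ℝ) + 1) * (l.factorial : ℝ) ^ 2))
      ((primitive^[l] (1 : ℝ[X])).eval a * (primitive^[l] (1 : ℝ[X])).eval a) a := by
    refine ((hasDerivAt_pow (2 * l + 1) a).div_const _).congr_deriv ?_
    rw [primitive_iterate_one]
    have : (l.factorial : ℝ) ≠ 0 := by positivity
    have : (2 * (l : ℝ) + 1) ≠ 0 := by positivity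
    simp
    field_simp
    ring
  have h2 : HasDerivAt (fun a : ℝ => ∑ j ∈ Finset.range (n + 1), (2 * (j : ℝ) + 1) *
      (primitive^[l + 1] (legendre j)).eval a ^ 2)
      (∑ j ∈ Finset.range (n + 1), (2 * (2 * (j : ℝ) + 1)) *
        ((primitive^[l + 1] (legendre j)).eval a * (primitive^[l] (legendre j)).eval a)) a := by
    refine HasDerivAt.fun_sum fun j _ => ?_
    have h3 : HasDerivAt (fun x => (primitive^[l + 1] (legendre j)).eval x)
        ((primitive^[l] (legendre j)).eval a) a := by
      have h4 := (primitive^[l + 1] (legendre j)).hasDerivAt a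
      rwa [show derivative (primitive^[l + 1] (legendre j)) = primitive^[l] (legendre j) by
        rw [Function.iterate_succ_apply', derivative_primitive]] at h4
    refine ((h3.pow 2).const_mul (2 * (j : ℝ) + 1)).congr_deriv ?_
    simp
    ring
  have h4 := congrArg (Polynomial.eval a) (sum_primitive_mul l n)
  simp only [eval_finsetSum, eval_smul, eval_mul, eval_add, smul_eq_mul] at h4
  rw [h4] at h2
  refine (h1.sub h2).congr_deriv ?_
  ring

theorem eval_iterate_three_rodrigues (m : ℕ) (a : ℝ) :
    (derivative^[3] ((X ^ 2 - X : ℝ[X]) ^ (m + 3))).eval a =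
      ((m : ℝ) + 3) * (m + 2) * (2 * a - 1) * (a ^ 2 - a) ^ m *
        (m + 1 + (4 * m + 10) * (a ^ 2 - a)) := by
  have h : derivative^[3] ((X ^ 2 - X : ℝ[X]) ^ (m + 3)) =
      derivative (derivative (derivative ((X ^ 2 - X : ℝ[X]) ^ (m + 1 + 2)))) := rfl
  rw [h, derivative_derivative_rodrigues]
  simp [derivative_pow]
  ring

/-- An even number of derivatives gives a polynomial in a² − a alone:
`derivative_derivative_rodrigues` is applied twice, while the third derivative acquires the odd
factor 2a − 1. -/
theorem eval_iterate_four_rodrigues (m : ℕ) (a : ℝ) :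
    (derivative^[4] ((X ^ 2 - X : ℝ[X]) ^ (m + 4))).eval a =
      ((m : ℝ) + 4) * (m + 3) * (a ^ 2 - a) ^ m *
        ((m + 2) * (m + 1) + 4 * (m + 2) * (2 * m + 5) * (a ^ 2 - a) +
          4 * (2 * m + 7) * (2 * m + 5) * (a ^ 2 - a) ^ 2) := by
  have h : derivative^[4] ((X ^ 2 - X : ℝ[X]) ^ (m + 4)) =
      derivative (derivative (derivative (derivative ((X ^ 2 - X : ℝ[X]) ^ (m + 2 + 2))))) := rfl
  rw [h, derivative_derivative_rodrigues]
  simp only [derivative_add, derivative_smul]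
  rw [derivative_derivative_rodrigues, show m + 2 + 1 = m + 1 + 2 by ring,
    derivative_derivative_rodrigues]
  simp
  ring

/-- The derivative of `formula3 (m + 4)`, before factorization of the quadratic factor. -/
def slope3 (m : ℕ) (t : ℝ) : ℝ :=
  -((m + 2) / ((m + 2).factorial : ℝ) ^ 2) * t ^ (2 * m) *
    (((m : ℝ) + 2) * (m + 1) + 4 * (m + 2) * (2 * m + 5) * t +
      4 * (2 * m + 7) * (2 * m + 5) * t ^ 2) * (m + 1 + (4 * m + 10) * t)

theorem hasDerivAt_formula3 (m : ℕ) (t : ℝ) :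
    HasDerivAt (formula3 (m + 4)) (slope3 m t) t := by
  have hm : (2 * (m : ℝ) + 1) ≠ 0 := by positivity
  have hf : ((m + 2).factorial : ℝ) ≠ 0 := by positivity
  -- The cubic is written as a formal polynomial so that its derivative can be computed by `simp`.
  let Q : ℝ[X] := C (4 * (2 * (m : ℝ) + 7) * (2 * m + 5) ^ 2 * (2 * m + 1)) * X ^ 3 +
    C (12 * ((m : ℝ) + 3) * (m + 2) * (2 * m + 5) * (2 * m + 1)) * X ^ 2 +
    C (3 * ((m : ℝ) + 2) ^ 2 * (2 * m + 5) * (2 * m + 1)) * X +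
    C (((m : ℝ) + 2) ^ 2 * (m + 1) ^ 2)
  have h1 : formula3 (m + 4) = fun t : ℝ =>
      -(((m + 2).factorial : ℝ) ^ 2 * (2 * (m : ℝ) + 1))⁻¹ * (t ^ (2 * m + 1) * Q.eval t) := by
    funext t
    rw [formula3, show 2 * (m + 4) - 7 = 2 * m + 1 by omega, show m + 4 - 2 = m + 2 by omega]
    simp only [Q, eval_add, eval_mul, eval_C, eval_pow, eval_X]
    push_cast
    rw [show 2 * ((m : ℝ) + 4) - 7 = 2 * m + 1 by ring]
    ring
  rw [h1]
  refine (((hasDerivAt_pow (2 * m + 1) t).mul (Q.hasDerivAt t)).const_mul _).congr_deriv ?_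
  rw [slope3]
  simp [Q, derivative_pow]
  field_simp
  ring

theorem hasDerivAt_sq_sub_self (a : ℝ) : HasDerivAt (fun a : ℝ => a ^ 2 - a) (2 * a - 1) a := by
  refine ((hasDerivAt_pow 2 a).sub (hasDerivAt_id a)).congr_deriv ?_
  simp

theorem hasDerivAt_formula3_comp (m : ℕ) (a : ℝ) :
    HasDerivAt (fun a : ℝ => formula3 (m + 4) (a ^ 2 - a))
      (slope3 m (a ^ 2 - a) * (2 * a - 1)) a :=
  HasDerivAt.comp (h := fun a : ℝ => a ^ 2 - a) a (hasDerivAt_formula3 m (a ^ 2 - a))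
    (hasDerivAt_sq_sub_self a)

/-- Both sides are differentiable on the whole line with the same derivative and vanish at 0, so the
identity holds without restricting `a` to [0, 1]. -/
theorem distSq_eq_formula3 (m : ℕ) (a : ℝ) :
    distSq (m + 4) m a = formula3 (m + 4) (a ^ 2 - a) := by
  have hd2 : ∀ a : ℝ, HasDerivAt (distSq (m + 4) m) (slope3 m (a ^ 2 - a) * (2 * a - 1)) a := by
    intro a
    refine (hasDerivAt_distSq (m + 3) m a).congr_deriv ?_
    rw [primitive_iterate_legendre (by omega), primitive_iterate_legendre (by omega),
      show m + 3 + 1 - m = 4 by omega, show m + 3 - m = 3 by omega, eval_smul, eval_smul,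
      eval_iterate_three_rodrigues, show m + 3 + 1 = m + 4 by ring, eval_iterate_four_rodrigues,
      slope3, Nat.factorial_succ (m + 3), Nat.factorial_succ (m + 2)]
    have hf : ((m + 2).factorial : ℝ) ≠ 0 := by positivity
    push_cast
    simp only [smul_eq_mul]
    field_simp
    ring
  have h3 : ∀ x y, distSq (m + 4) m x - formula3 (m + 4) (x ^ 2 - x) =
      distSq (m + 4) m y - formula3 (m + 4) (y ^ 2 - y) :=
    is_const_of_deriv_eq_zero
      (fun x => ((hd2 x).sub (hasDerivAt_formula3_comp m x)).differentiableAt)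
      (fun x => by
        have := ((hd2 x).sub (hasDerivAt_formula3_comp m x)).deriv
        rw [sub_self] at this
        exact this)
  have h4 := h3 a 0
  have h5 : distSq (m + 4) m 0 = 0 := by
    simp [distSq, Function.iterate_succ_apply', eval_zero_primitive]
  have h6 : formula3 (m + 4) (0 ^ 2 - 0) = 0 := by
    have : 2 * (m + 4) - 7 ≠ 0 := by omega
    simp [formula3, this]
  rw [h5, h6, sub_self] at h4
  exact sub_eq_zero.mp h4

end SobolevEmbedding

end

/-! ### Monotonicity in t, and comparison of the two peaks. -/

noncomputable section

namespace SobolevEmbedding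

/-- The square root in the closed forms of `t₁` and `t₂`. -/
def root3 (n : ℕ) : ℝ := √(3 * ((n : ℝ) - 2) * (2 * n - 3))

theorem root3_sq (m : ℕ) : root3 (m + 4) ^ 2 = 3 * ((m : ℝ) + 2) * (2 * m + 5) := by
  rw [root3, Real.sq_sqrt]
  · push_cast
    ring
  · push_cast
    have : (0 : ℝ) ≤ m := Nat.cast_nonneg m
    have h1 : (0 : ℝ) ≤ (m : ℝ) + 4 - 2 := by linarith
    have h2 : (0 : ℝ) ≤ 2 * ((m : ℝ) + 4) - 3 := by linarith
    positivity

theorem root3_pos (m : ℕ) : 0 < root3 (m + 4) := by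
  have h := root3_sq m
  have h1 : 0 ≤ root3 (m + 4) := Real.sqrt_nonneg _
  have h2 : (0 : ℝ) < 3 * ((m : ℝ) + 2) * (2 * m + 5) := by positivity
  rcases h1.eq_or_lt with h3 | h3
  · rw [← h3] at h
    linarith
  · exact h3

/-- This bound and the next two are t₃ < t₂, −1/4 < t₁ and t₂ < 0 after clearing denominators; the 3
is (m + 2)(2m + 5) − (m + 1)(2m + 7). -/
theorem three_lt_root3 (m : ℕ) : 3 < root3 (m + 4) := by
  have h := root3_sq m
  have : (0 : ℝ) ≤ m := Nat.cast_nonneg m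
  nlinarith [root3_pos m]

theorem two_mul_root3_lt (m : ℕ) : 2 * root3 (m + 4) < 3 * (2 * m + 5) := by
  have h := root3_sq m
  have : (0 : ℝ) ≤ m := Nat.cast_nonneg m
  apply lt_of_pow_lt_pow_left₀ 2 (by positivity)
  nlinarith

theorem root3_lt (m : ℕ) : root3 (m + 4) < ((m : ℝ) + 2) * (2 * m + 5) := by
  have h := root3_sq m
  have : (0 : ℝ) ≤ m := Nat.cast_nonneg m
  apply lt_of_pow_lt_pow_left₀ 2 (by positivity)
  rw [h]
  have h2 : (3 : ℝ) < ((m : ℝ) + 2) * (2 * m + 5) := by nlinarith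
  nlinarith

theorem t₁_eq (m : ℕ) : t₁ (m + 4) =
    (-(((m : ℝ) + 2) * (2 * m + 5)) - root3 (m + 4)) / (2 * (2 * (m : ℝ) + 7) * (2 * m + 5)) := by
  rw [t₁, root3]
  push_cast
  congr 1 <;> ring_nf

theorem t₂_eq (m : ℕ) : t₂ (m + 4) =
    (-(((m : ℝ) + 2) * (2 * m + 5)) + root3 (m + 4)) / (2 * (2 * (m : ℝ) + 7) * (2 * m + 5)) := by
  rw [t₂, root3]
  push_cast
  congr 1 <;> ring_nf

theorem t₃_eq (m : ℕ) : t₃ (m + 4) = -(((m : ℝ) + 1) / (2 * (2 * (m : ℝ) + 5))) := by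
  rw [t₃]
  push_cast
  congr 2 <;> ring_nf

theorem neg_quarter_lt_t₁ (m : ℕ) : -(1 / 4) < t₁ (m + 4) := by
  rw [t₁_eq, lt_div_iff₀ (by positivity)]
  nlinarith [two_mul_root3_lt m]

theorem t₁_lt_t₃ (m : ℕ) : t₁ (m + 4) < t₃ (m + 4) := by
  rw [t₁_eq, t₃_eq, ← neg_div, div_lt_div_iff₀ (by positivity) (by positivity)]
  have h1 : (0 : ℝ) < 2 * (2 * (m : ℝ) + 5) := by positivity
  nlinarith [mul_pos h1 (root3_pos m)]

theorem t₃_lt_t₂ (m : ℕ) : t₃ (m + 4) < t₂ (m + 4) := by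
  rw [t₂_eq, t₃_eq, ← neg_div, div_lt_div_iff₀ (by positivity) (by positivity)]
  have h1 : (0 : ℝ) < 2 * (2 * (m : ℝ) + 5) := by positivity
  nlinarith [mul_lt_mul_of_pos_left (three_lt_root3 m) h1]

theorem t₂_neg (m : ℕ) : t₂ (m + 4) < 0 := by
  rw [t₂_eq]
  exact div_neg_of_neg_of_pos (by linarith [root3_lt m]) (by positivity)

theorem slope3_eq (m : ℕ) (t : ℝ) :
    slope3 m t = -((m + 2) / ((m + 2).factorial : ℝ) ^ 2 * (8 * (2 * m + 7) * (2 * m + 5) ^ 2) *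
      t ^ (2 * m)) * ((t - t₁ (m + 4)) * (t - t₂ (m + 4)) * (t - t₃ (m + 4))) := by
  have h1 : 4 * (2 * (m : ℝ) + 7) * (2 * m + 5) * ((t - t₁ (m + 4)) * (t - t₂ (m + 4))) =
      ((m : ℝ) + 2) * (m + 1) + 4 * (m + 2) * (2 * m + 5) * t +
        4 * (2 * m + 7) * (2 * m + 5) * t ^ 2 := by
    have hσ := root3_sq m
    rw [t₁_eq, t₂_eq]
    generalize root3 (m + 4) = σ at hσ ⊢
    field_simp
    linear_combination -4 * hσ
  have h2 : 2 * (2 * (m : ℝ) + 5) * (t - t₃ (m + 4)) = m + 1 + (4 * m + 10) * t := by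
    rw [t₃_eq]
    field_simp
    ring
  rw [slope3, ← h1, ← h2]
  ring

theorem slope3_coeff_pos (m : ℕ) {t : ℝ} (ht : t ≠ 0) :
    0 < (m + 2) / ((m + 2).factorial : ℝ) ^ 2 * (8 * (2 * m + 7) * (2 * m + 5) ^ 2) *
      t ^ (2 * m) := by
  rw [pow_mul]
  positivity

theorem slope3_eq_zero_iff (m : ℕ) {t : ℝ} (ht : t ≠ 0) :
    slope3 m t = 0 ↔ t = t₁ (m + 4) ∨ t = t₂ (m + 4) ∨ t = t₃ (m + 4) := by
  rw [slope3_eq, mul_eq_zero, or_iff_right (neg_ne_zero.mpr (slope3_coeff_pos m ht).ne'),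
    mul_eq_zero, mul_eq_zero, sub_eq_zero, sub_eq_zero, sub_eq_zero, or_assoc]

theorem continuous_formula3 (m : ℕ) : Continuous (formula3 (m + 4)) :=
  continuous_iff_continuousAt.mpr fun t => (hasDerivAt_formula3 m t).continuousAt

theorem strictMonoOn_formula3_left (m : ℕ) :
    StrictMonoOn (formula3 (m + 4)) (Icc (-(1 / 4)) (t₁ (m + 4))) := by
  refine strictMonoOn_of_deriv_pos (convex_Icc _ _) (continuous_formula3 m).continuousOn ?_
  intro t ht
  rw [interior_Icc] at ht
  have h12 := t₁_lt_t₃ m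
  have h23 := t₃_lt_t₂ m
  have h3 := t₂_neg m
  have hc := slope3_coeff_pos m (t := t) (by linarith [ht.2])
  rw [(hasDerivAt_formula3 m t).deriv, slope3_eq]
  refine mul_pos_of_neg_of_neg (neg_lt_zero.mpr hc) (mul_neg_of_pos_of_neg
    (mul_pos_of_neg_of_neg ?_ ?_) ?_) <;> linarith [ht.1, ht.2]

theorem strictAntiOn_formula3_left (m : ℕ) :
    StrictAntiOn (formula3 (m + 4)) (Icc (t₁ (m + 4)) (t₃ (m + 4))) := by
  refine strictAntiOn_of_deriv_neg (convex_Icc _ _) (continuous_formula3 m).continuousOn ?_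
  intro t ht
  rw [interior_Icc] at ht
  have h23 := t₃_lt_t₂ m
  have h3 := t₂_neg m
  have hc := slope3_coeff_pos m (t := t) (by linarith [ht.2])
  rw [(hasDerivAt_formula3 m t).deriv, slope3_eq]
  refine mul_neg_of_neg_of_pos (neg_lt_zero.mpr hc) (mul_pos_of_neg_of_neg
    (mul_neg_of_pos_of_neg ?_ ?_) ?_) <;> linarith [ht.1, ht.2]

theorem strictMonoOn_formula3_right (m : ℕ) :
    StrictMonoOn (formula3 (m + 4)) (Icc (t₃ (m + 4)) (t₂ (m + 4))) := by
  refine strictMonoOn_of_deriv_pos (convex_Icc _ _) (continuous_formula3 m).continuousOn ?_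
  intro t ht
  rw [interior_Icc] at ht
  have h12 := t₁_lt_t₃ m
  have h3 := t₂_neg m
  have hc := slope3_coeff_pos m (t := t) (by linarith [ht.2])
  rw [(hasDerivAt_formula3 m t).deriv, slope3_eq]
  refine mul_pos_of_neg_of_neg (neg_lt_zero.mpr hc) (mul_neg_of_neg_of_pos
    (mul_neg_of_pos_of_neg ?_ ?_) ?_) <;> linarith [ht.1, ht.2]

theorem strictAntiOn_formula3_right (m : ℕ) :
    StrictAntiOn (formula3 (m + 4)) (Icc (t₂ (m + 4)) 0) := by
  refine strictAntiOn_of_deriv_neg (convex_Icc _ _) (continuous_formula3 m).continuousOn ?_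
  intro t ht
  rw [interior_Icc] at ht
  have h12 := t₁_lt_t₃ m
  have h23 := t₃_lt_t₂ m
  have hc := slope3_coeff_pos m (t := t) (by linarith [ht.2])
  rw [(hasDerivAt_formula3 m t).deriv, slope3_eq]
  refine mul_neg_of_neg_of_pos (neg_lt_zero.mpr hc) (mul_pos
    (mul_pos ?_ ?_) ?_) <;> linarith [ht.1, ht.2]

theorem isLocalMax_of_strictMonoOn_strictAntiOn {f : ℝ → ℝ} {a b c : ℝ} (hab : a < b) (hbc : b < c)
    (h1 : StrictMonoOn f (Icc a b)) (h2 : StrictAntiOn f (Icc b c)) : IsLocalMax f b := by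
  filter_upwards [Icc_mem_nhds hab hbc] with t ht
  rcases le_total t b with h | h
  · exact h1.monotoneOn ⟨ht.1, h⟩ ⟨hab.le, le_rfl⟩ h
  · exact h2.antitoneOn ⟨le_rfl, hbc.le⟩ ⟨h, ht.2⟩ h

theorem isLocalMin_of_strictAntiOn_strictMonoOn {f : ℝ → ℝ} {a b c : ℝ} (hab : a < b) (hbc : b < c)
    (h1 : StrictAntiOn f (Icc a b)) (h2 : StrictMonoOn f (Icc b c)) : IsLocalMin f b := by
  filter_upwards [Icc_mem_nhds hab hbc] with t ht
  rcases le_total t b with h | h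
  · exact h1.antitoneOn ⟨ht.1, h⟩ ⟨hab.le, le_rfl⟩ h
  · exact h2.monotoneOn ⟨le_rfl, hbc.le⟩ ⟨h, ht.2⟩ h

theorem isLocalMax_formula3_t₁ (m : ℕ) : IsLocalMax (formula3 (m + 4)) (t₁ (m + 4)) :=
  isLocalMax_of_strictMonoOn_strictAntiOn (neg_quarter_lt_t₁ m) (t₁_lt_t₃ m)
    (strictMonoOn_formula3_left m) (strictAntiOn_formula3_left m)

theorem isLocalMax_formula3_t₂ (m : ℕ) : IsLocalMax (formula3 (m + 4)) (t₂ (m + 4)) :=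
  isLocalMax_of_strictMonoOn_strictAntiOn (t₃_lt_t₂ m) (t₂_neg m)
    (strictMonoOn_formula3_right m) (strictAntiOn_formula3_right m)

theorem isLocalMin_formula3_t₃ (m : ℕ) : IsLocalMin (formula3 (m + 4)) (t₃ (m + 4)) :=
  isLocalMin_of_strictAntiOn_strictMonoOn (t₁_lt_t₃ m) (t₃_lt_t₂ m)
    (strictAntiOn_formula3_left m) (strictMonoOn_formula3_right m)

/-- The value of `formula3` at a root of its quadratic factor; `σ` is one of the two square
roots. -/
theorem formula3_at_root (m : ℕ) {σ : ℝ} (hσ : σ ^ 2 = 3 * ((m : ℝ) + 2) * (2 * m + 5)) :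
    formula3 (m + 4)
        ((-(((m : ℝ) + 2) * (2 * m + 5)) - σ) / (2 * (2 * (m : ℝ) + 7) * (2 * m + 5))) =
      ((((m : ℝ) + 2) * (2 * m + 5) + σ) / ((2 * (m : ℝ) + 7) * (2 * m + 5))) ^ (2 * m + 1) *
        (3 * ((m : ℝ) + 2) * (3 * ((m : ℝ) + 2) * (2 * m + 3) - (2 * m + 1) * σ) /
          (4 ^ (m + 1) * ((m + 2).factorial : ℝ) ^ 2 * (2 * (m : ℝ) + 7) ^ 2 * (2 * m + 1))) := by
  set t : ℝ := (-(((m : ℝ) + 2) * (2 * m + 5)) - σ) / (2 * (2 * (m : ℝ) + 7) * (2 * m + 5)) with ht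
  set w : ℝ := (((m : ℝ) + 2) * (2 * m + 5) + σ) / ((2 * (m : ℝ) + 7) * (2 * m + 5)) with hw
  have hf : ((m + 2).factorial : ℝ) ≠ 0 := by positivity
  have htw : t = -(w / 2) := by
    rw [ht, hw]
    field_simp
    ring
  have hpow : -t ^ (2 * m + 1) = w ^ (2 * m + 1) * (2 / 4 ^ (m + 1)) := by
    rw [htw, Odd.neg_pow ⟨m, rfl⟩, neg_neg, div_pow, show (4 : ℝ) = 2 ^ 2 by norm_num, ← pow_mul,
      show 2 * (m + 1) = 2 * m + 1 + 1 by ring, pow_succ 2 (2 * m + 1)]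
    field_simp
  -- Eliminating σ² makes t² linear in σ, and reduces the cubic in `hQ` to an expression linear in
  -- σ.
  have ht2 : t ^ 2 = ((m : ℝ) + 2) * (((m : ℝ) + 2) * (2 * m + 5) + 2 * σ + 3) /
      (4 * (2 * (m : ℝ) + 7) ^ 2 * (2 * m + 5)) := by
    rw [ht, div_pow, div_eq_div_iff (by positivity) (by positivity)]
    linear_combination 4 * (2 * (m : ℝ) + 7) ^ 2 * (2 * m + 5) * hσ
  have hQ : 4 * (2 * (m : ℝ) + 7) * (2 * m + 5) ^ 2 * (2 * m + 1) * t ^ 3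
      + 12 * ((m : ℝ) + 3) * (m + 2) * (2 * m + 5) * (2 * m + 1) * t ^ 2
      + 3 * ((m : ℝ) + 2) ^ 2 * (2 * m + 5) * (2 * m + 1) * t
      + ((m : ℝ) + 2) ^ 2 * (m + 1) ^ 2 =
      3 * ((m : ℝ) + 2) * (3 * ((m : ℝ) + 2) * (2 * m + 3) - (2 * m + 1) * σ) /
        (2 * (2 * (m : ℝ) + 7) ^ 2) := by
    rw [pow_succ t 2, ht2, ht]
    field_simp
    ring_nf
    rw [hσ]
    ring
  rw [formula3, show 2 * (m + 4) - 7 = 2 * m + 1 by omega, show m + 4 - 2 = m + 2 by omega, hpow]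
  push_cast
  have e1 : 2 * ((m : ℝ) + 4) - 7 = 2 * m + 1 := by ring
  have e2 : 2 * ((m : ℝ) + 4) - 1 = 2 * m + 7 := by ring
  have e3 : 2 * ((m : ℝ) + 4) - 3 = 2 * m + 5 := by ring
  have e4 : (m : ℝ) + 4 - 1 = m + 3 := by ring
  have e5 : (m : ℝ) + 4 - 2 = m + 2 := by ring
  have e6 : (m : ℝ) + 4 - 3 = m + 1 := by ring
  rw [e1, e2, e3, e4, e5, e6, hQ]
  field_simp

theorem formula3_t₁ (m : ℕ) : formula3 (m + 4) (t₁ (m + 4)) = const3 (m + 4) := by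
  rw [t₁_eq, formula3_at_root m (root3_sq m), const3, show 2 * (m + 4) - 7 = 2 * m + 1 by omega,
    show m + 4 - 2 = m + 2 by omega, show m + 4 - 3 = m + 1 by omega]
  have h : root3 (m + 4) = √3 * √((m + 2) * (2 * m + 5)) := by
    rw [root3, ← Real.sqrt_mul (by norm_num)]
    push_cast
    congr 1
    ring
  have h' : √(3 * (((m + 4 : ℕ) : ℝ) - 2) * (2 * ((m + 4 : ℕ) : ℝ) - 3)) = root3 (m + 4) := rfl
  rw [h']
  push_cast
  have e1 : 2 * ((m : ℝ) + 4) - 7 = 2 * m + 1 := by ring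
  have e2 : 2 * ((m : ℝ) + 4) - 1 = 2 * m + 7 := by ring
  have e3 : 2 * ((m : ℝ) + 4) - 3 = 2 * m + 5 := by ring
  have e4 : 2 * ((m : ℝ) + 4) - 5 = 2 * m + 3 := by ring
  have e5 : (m : ℝ) + 4 - 2 = m + 2 := by ring
  rw [e1, e2, e3, e4, e5, mul_right_comm (√3), ← h, mul_comm (root3 (m + 4)) (2 * (m : ℝ) + 1)]

/-- Here y stands for (2m + 1)S/B in the notation of `pow_mul_lt_pow_mul`. For large m the quadratic
−4m² must be beaten by 2m²y, and y tends to √6, so a rational lower bound for y close to √6 is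
enough. -/
theorem cubic_root_bound (m : ℕ) {y : ℝ} (hy0 : 0 < y)
    (hy : ((m : ℝ) + 2) * (2 * m + 5) * y ^ 2 = 3 * (2 * m + 1) ^ 2) :
    0 < (-4 * (m : ℝ) ^ 2 + 12 * m + 13) + (m + 2) * (2 * m - 1) * y := by
  -- For m = 0 the coefficient 2m − 1 of y is negative, so a lower bound on y would not help.
  rcases Nat.eq_zero_or_pos m with rfl | hm
  · norm_num at hy ⊢
    nlinarith
  have hm1 : (1 : ℝ) ≤ m := by exact_mod_cast hm
  -- AM–GM gives √((m + 2)(2m + 5)) ≤ √2(4m + 9)/4, hence y ≥ 2√6(2m + 1)/(4m + 9); the constant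
  -- 24/5 lies just below 2√6.
  have h1 : 24 * (2 * (m : ℝ) + 1) ≤ 5 * (4 * m + 9) * y := by
    refine (sq_le_sq₀ (by positivity) (by positivity)).mp ?_
    have hB : (0 : ℝ) < ((m : ℝ) + 2) * (2 * m + 5) := by positivity
    refine le_of_mul_le_mul_left ?_ hB
    have h2 : ((m : ℝ) + 2) * (2 * m + 5) * (5 * (4 * m + 9) * y) ^ 2 =
        25 * (4 * m + 9) ^ 2 * (3 * (2 * m + 1) ^ 2) := by
      rw [← hy]
      ring
    rw [h2]
    have h3 : 576 * (((m : ℝ) + 2) * (2 * m + 5)) ≤ 75 * (4 * m + 9) ^ 2 := by nlinarith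
    nlinarith [mul_le_mul_of_nonneg_right h3 (sq_nonneg (2 * (m : ℝ) + 1))]
  have h4 : (0 : ℝ) < 5 * (4 * m + 9) := by positivity
  refine pos_of_mul_pos_right (a := 5 * (4 * (m : ℝ) + 9)) ?_ h4.le
  have h5 : (0 : ℝ) ≤ ((m : ℝ) + 2) * (2 * m - 1) := mul_nonneg (by linarith) (by linarith)
  have h6 := mul_le_mul_of_nonneg_left h1 h5
  nlinarith [mul_nonneg (sub_nonneg.mpr hm1) (sub_nonneg.mpr hm1),
    mul_nonneg (mul_nonneg (sub_nonneg.mpr hm1) (sub_nonneg.mpr hm1)) (sub_nonneg.mpr hm1)]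

/-- With u = S/B and N = 2m + 1, multiply by (1 + u)ᴺ. The left side is then bounded using (1 − u²)ᴺ
≤ 1, and the right side using Bernoulli, (1 + u)ᴺ ≥ 1 + Nu = 1 + y. What remains is Y + By < (1 +
y)²(Y − By), which becomes `cubic_root_bound` once By² is replaced by its value. -/
theorem pow_mul_lt_pow_mul (m : ℕ) {S : ℝ} (hS0 : 0 < S)
    (hS : S ^ 2 = 3 * ((m : ℝ) + 2) * (2 * m + 5)) (hSB : S < ((m : ℝ) + 2) * (2 * m + 5)) :
    (((m : ℝ) + 2) * (2 * m + 5) - S) ^ (2 * m + 1) *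
        (3 * ((m : ℝ) + 2) * (2 * m + 3) + (2 * m + 1) * S) <
      (((m : ℝ) + 2) * (2 * m + 5) + S) ^ (2 * m + 1) *
        (3 * ((m : ℝ) + 2) * (2 * m + 3) - (2 * m + 1) * S) := by
  set B : ℝ := ((m : ℝ) + 2) * (2 * m + 5) with hB
  have hm0 : (0 : ℝ) ≤ m := Nat.cast_nonneg m
  have hBpos : 0 < B := by positivity
  set Y : ℝ := 3 * ((m : ℝ) + 2) * (2 * m + 3) with hY
  set u : ℝ := S / B with hu
  have hu0 : 0 < u := div_pos hS0 hBpos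
  have hu1 : u < 1 := (div_lt_one hBpos).mpr hSB
  have hSu : S = B * u := by
    rw [hu]
    field_simp
  set y : ℝ := (2 * (m : ℝ) + 1) * u with hy
  have hy0 : 0 < y := by positivity
  have hMS : (2 * (m : ℝ) + 1) * S = B * y := by
    rw [hSu, hy]
    ring
  have hBy : B * y ^ 2 = 3 * (2 * (m : ℝ) + 1) ^ 2 := by
    have h1 : B * (B * u ^ 2) = B * 3 := by
      have : B * (B * u ^ 2) = S ^ 2 := by
        rw [hSu]
        ring
      rw [this, hS, hB]
      ring
    have h2 := mul_left_cancel₀ hBpos.ne' h1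
    rw [hy]
    linear_combination (2 * (m : ℝ) + 1) ^ 2 * h2
  -- Positivity of this factor is what allows 1 + y to be replaced by the larger (1 + u)ᴺ in front
  -- of it.
  have hgap : 0 < Y - B * y := by
    rw [sub_pos]
    apply lt_of_pow_lt_pow_left₀ 2 (by positivity)
    rw [mul_pow, sq B, mul_assoc, hBy, hB, hY]
    have h1 : (2 * (m : ℝ) + 5) * (2 * m + 1) ^ 2 < 3 * (m + 2) * (2 * m + 3) ^ 2 := by
      nlinarith [mul_nonneg hm0 hm0, mul_nonneg (mul_nonneg hm0 hm0) hm0]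
    nlinarith [mul_lt_mul_of_pos_left h1 (show (0 : ℝ) < 3 * ((m : ℝ) + 2) by positivity)]
  have hkey : Y + B * y < (1 + y) ^ 2 * (Y - B * y) := by
    have h1 := mul_pos hy0 (cubic_root_bound m hy0 (by rw [← hB]; exact hBy))
    have h2 : (1 + y) ^ 2 * (Y - B * y) - (Y + B * y) =
        y * ((-4 * (m : ℝ) ^ 2 + 12 * m + 13) + (m + 2) * (2 * m - 1) * y) := by
      rw [hY]
      have h3 : B * y ^ 3 = 3 * (2 * (m : ℝ) + 1) ^ 2 * y := by
        rw [← hBy]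
        ring
      linear_combination -h3 + (2 * y + 2 * y ^ 2) * (-hB)
    linarith
  have hP : 1 + y ≤ (1 + u) ^ (2 * m + 1) := by
    have := one_add_mul_le_pow (show (-2 : ℝ) ≤ u by linarith) (2 * m + 1)
    push_cast at this
    exact this
  have hPR : (1 + u) ^ (2 * m + 1) * (1 - u) ^ (2 * m + 1) ≤ 1 := by
    rw [← mul_pow]
    exact pow_le_one₀ (mul_nonneg (by linarith) (by linarith)) (by nlinarith)
  have hPpos : 0 < (1 + u) ^ (2 * m + 1) := by positivity
  have hmain : (1 - u) ^ (2 * m + 1) * (Y + B * y) < (1 + u) ^ (2 * m + 1) * (Y - B * y) := by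
    refine lt_of_mul_lt_mul_left ?_ hPpos.le
    calc (1 + u) ^ (2 * m + 1) * ((1 - u) ^ (2 * m + 1) * (Y + B * y))
        = (1 + u) ^ (2 * m + 1) * (1 - u) ^ (2 * m + 1) * (Y + B * y) := by ring
      _ ≤ 1 * (Y + B * y) := mul_le_mul_of_nonneg_right hPR (by positivity)
      _ < (1 + y) ^ 2 * (Y - B * y) := by rw [one_mul]; exact hkey
      _ ≤ ((1 + u) ^ (2 * m + 1)) ^ 2 * (Y - B * y) := by gcongr
      _ = (1 + u) ^ (2 * m + 1) * ((1 + u) ^ (2 * m + 1) * (Y - B * y)) := by ring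
  rw [hMS, show B - S = B * (1 - u) by rw [hSu]; ring, show B + S = B * (1 + u) by rw [hSu]; ring,
    mul_pow B (1 - u), mul_pow B (1 + u), mul_assoc (B ^ (2 * m + 1)),
    mul_assoc (B ^ (2 * m + 1))]
  exact mul_lt_mul_of_pos_left hmain (pow_pos hBpos _)

theorem formula3_t₂_lt (m : ℕ) :
    formula3 (m + 4) (t₂ (m + 4)) < formula3 (m + 4) (t₁ (m + 4)) := by
  have h2 := formula3_at_root m (σ := -root3 (m + 4)) (by rw [neg_sq, root3_sq])
  rw [sub_neg_eq_add, ← t₂_eq] at h2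
  have h1 := formula3_at_root m (root3_sq m)
  rw [← t₁_eq] at h1
  rw [h1, h2, div_pow, div_pow, div_mul_div_comm, div_mul_div_comm]
  refine div_lt_div_of_pos_right ?_ (by positivity)
  have h3 := mul_lt_mul_of_pos_left (pow_mul_lt_pow_mul m (root3_pos m) (root3_sq m) (root3_lt m))
    (show (0 : ℝ) < 3 * ((m : ℝ) + 2) by positivity)
  convert h3 using 1 <;> ring

theorem formula3_lt_of_ne (m : ℕ) {t : ℝ} (ht : t ∈ Icc (-(1 / 4) : ℝ) 0) (hne : t ≠ t₁ (m + 4)) :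
    formula3 (m + 4) t < formula3 (m + 4) (t₁ (m + 4)) := by
  have h01 := neg_quarter_lt_t₁ m
  have h13 := t₁_lt_t₃ m
  have h32 := t₃_lt_t₂ m
  have h2 := t₂_neg m
  rcases lt_or_gt_of_ne hne with h | h
  · exact strictMonoOn_formula3_left m ⟨ht.1, h.le⟩ ⟨h01.le, le_rfl⟩ h
  rcases le_total t (t₃ (m + 4)) with h' | h'
  · exact strictAntiOn_formula3_left m ⟨le_rfl, h13.le⟩ ⟨h.le, h'⟩ h
  -- To the right of t₃ the value is at most that of the lower peak t₂.
  refine lt_of_le_of_lt ?_ (formula3_t₂_lt m)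
  rcases le_total t (t₂ (m + 4)) with h'' | h''
  · exact (strictMonoOn_formula3_right m).monotoneOn ⟨h', h''⟩ ⟨h32.le, le_rfl⟩ h''
  · exact (strictAntiOn_formula3_right m).antitoneOn ⟨le_rfl, h2.le⟩ ⟨h'', ht.2⟩ h''

end SobolevEmbedding

end

/-! ### Return from t to the variable a. -/

noncomputable section

namespace SobolevEmbedding

theorem aPlus_sq_sub {t : ℝ} (ht : -(1 / 4) ≤ t) : aPlus t ^ 2 - aPlus t = t := by
  have h : √(1 + 4 * t) ^ 2 = 1 + 4 * t := Real.sq_sqrt (by linarith)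
  rw [aPlus]
  linear_combination h / 4

theorem aMinus_sq_sub {t : ℝ} (ht : -(1 / 4) ≤ t) : aMinus t ^ 2 - aMinus t = t := by
  have h : √(1 + 4 * t) ^ 2 = 1 + 4 * t := Real.sq_sqrt (by linarith)
  rw [aMinus]
  linear_combination h / 4

theorem sq_sub_eq_iff {t : ℝ} (ht : -(1 / 4) ≤ t) (a : ℝ) :
    a ^ 2 - a = t ↔ a = aPlus t ∨ a = aMinus t := by
  constructor
  · intro h
    have h1 : √(1 + 4 * t) ^ 2 = 1 + 4 * t := Real.sq_sqrt (by linarith)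
    have h2 : (a - aPlus t) * (a - aMinus t) = 0 := by
      rw [aPlus, aMinus]
      linear_combination h - h1 / 4
    rcases mul_eq_zero.mp h2 with h3 | h3
    · exact Or.inl (sub_eq_zero.mp h3)
    · exact Or.inr (sub_eq_zero.mp h3)
  · rintro (rfl | rfl)
    · exact aPlus_sq_sub ht
    · exact aMinus_sq_sub ht

theorem mem_Ioo_of_sq_sub_neg {a : ℝ} (h : a ^ 2 - a < 0) : a ∈ Ioo (0 : ℝ) 1 := by
  constructor <;> nlinarith

theorem sq_sub_mem_Icc {a : ℝ} (ha : a ∈ Icc (0 : ℝ) 1) : a ^ 2 - a ∈ Icc (-(1 / 4) : ℝ) 0 := by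
  constructor
  · nlinarith [sq_nonneg (a - 1 / 2)]
  · nlinarith [ha.1, ha.2]

variable (𝕜 : Type*) [RCLike 𝕜]

theorem A_sq_eq_formula3 (m : ℕ) {a : ℝ} (ha : a ∈ Icc (0 : ℝ) 1) :
    A 𝕜 (m + 4) 3 a ^ 2 = formula3 (m + 4) (a ^ 2 - a) := by
  rw [A_sq_eq (l := m) (by omega) ha, distSq_eq_formula3]

theorem A_sq_eventuallyEq (m : ℕ) {a : ℝ} (ha : a ∈ Ioo (0 : ℝ) 1) :
    (fun a => A 𝕜 (m + 4) 3 a ^ 2) =ᶠ[nhds a] fun a => formula3 (m + 4) (a ^ 2 - a) := by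
  filter_upwards [Icc_mem_nhds ha.1 ha.2] with x hx
  exact A_sq_eq_formula3 𝕜 m hx

theorem hasDerivAt_A_sq (m : ℕ) {a : ℝ} (ha : a ∈ Ioo (0 : ℝ) 1) :
    HasDerivAt (fun a => A 𝕜 (m + 4) 3 a ^ 2) (slope3 m (a ^ 2 - a) * (2 * a - 1)) a :=
  (hasDerivAt_formula3_comp m a).congr_of_eventuallyEq (A_sq_eventuallyEq 𝕜 m ha)

theorem A_nonneg (n k : ℕ) (a : ℝ) : 0 ≤ A 𝕜 n k a := by
  refine Real.sSup_nonneg ?_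
  rintro _ ⟨f, -, -, rfl⟩
  exact norm_nonneg _

theorem isLocalMax_A_sq (m : ℕ) {a : ℝ} (ha : a ∈ Ioo (0 : ℝ) 1)
    (h : IsLocalMax (formula3 (m + 4)) (a ^ 2 - a)) :
    IsLocalMax (fun a => A 𝕜 (m + 4) 3 a ^ 2) a := by
  have h1 : IsLocalMax (fun a => formula3 (m + 4) (a ^ 2 - a)) a :=
    h.comp_continuous (g := fun a : ℝ => a ^ 2 - a) (b := a)
      (hasDerivAt_sq_sub_self a).continuousAt
  exact (Filter.EventuallyEq.isLocalMax_iff (A_sq_eventuallyEq 𝕜 m ha)).mpr h1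

theorem isLocalMin_A_sq (m : ℕ) {a : ℝ} (ha : a ∈ Ioo (0 : ℝ) 1)
    (h : IsLocalMin (formula3 (m + 4)) (a ^ 2 - a)) :
    IsLocalMin (fun a => A 𝕜 (m + 4) 3 a ^ 2) a := by
  have h1 : IsLocalMin (fun a => formula3 (m + 4) (a ^ 2 - a)) a :=
    h.comp_continuous (g := fun a : ℝ => a ^ 2 - a) (b := a)
      (hasDerivAt_sq_sub_self a).continuousAt
  exact (Filter.EventuallyEq.isLocalMin_iff (A_sq_eventuallyEq 𝕜 m ha)).mpr h1

/-- This minimum comes from the substitution, not from `formula3`: a² − a has its minimum −1/4 at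
1/2, and `formula3` increases from −1/4 up to t₁. -/
theorem isLocalMin_A_sq_half (m : ℕ) : IsLocalMin (fun a => A 𝕜 (m + 4) 3 a ^ 2) (1 / 2) := by
  have hev : ∀ᶠ a : ℝ in nhds (1 / 2), a ^ 2 - a < t₁ (m + 4) := by
    refine (hasDerivAt_sq_sub_self (1 / 2)).continuousAt.eventually_lt_const ?_
    norm_num
    linarith [neg_quarter_lt_t₁ m]
  filter_upwards [hev, Icc_mem_nhds (show (0 : ℝ) < 1 / 2 by norm_num)
    (show (1 / 2 : ℝ) < 1 by norm_num)] with a ha ha01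
  rw [A_sq_eq_formula3 𝕜 m ha01, A_sq_eq_formula3 𝕜 m (by norm_num)]
  have h1 := sq_sub_mem_Icc ha01
  have h2 : ((1 / 2 : ℝ) ^ 2 - 1 / 2) = -(1 / 4) := by norm_num
  rw [h2]
  exact (strictMonoOn_formula3_left m).monotoneOn ⟨le_rfl, (neg_quarter_lt_t₁ m).le⟩
    ⟨h1.1, ha.le⟩ h1.1

theorem isMaxOn_A_sq_iff (m : ℕ) {a : ℝ} (ha : a ∈ Icc (0 : ℝ) 1) :
    IsMaxOn (fun a => A 𝕜 (m + 4) 3 a ^ 2) (Icc 0 1) a ↔ a ^ 2 - a = t₁ (m + 4) := by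
  have hq := (neg_quarter_lt_t₁ m).le
  have h1 : t₁ (m + 4) < 0 := (t₁_lt_t₃ m).trans ((t₃_lt_t₂ m).trans (t₂_neg m))
  constructor
  · intro h
    by_contra hne
    have h2 := formula3_lt_of_ne m (sq_sub_mem_Icc ha) hne
    have hp : aPlus (t₁ (m + 4)) ∈ Icc (0 : ℝ) 1 :=
      Ioo_subset_Icc_self (mem_Ioo_of_sq_sub_neg (by rw [aPlus_sq_sub hq]; exact h1))
    have h3 : A 𝕜 (m + 4) 3 (aPlus (t₁ (m + 4))) ^ 2 ≤ A 𝕜 (m + 4) 3 a ^ 2 := h hp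
    rw [A_sq_eq_formula3 𝕜 m hp, A_sq_eq_formula3 𝕜 m ha, aPlus_sq_sub hq] at h3
    linarith
  · intro h x hx
    change A 𝕜 (m + 4) 3 x ^ 2 ≤ A 𝕜 (m + 4) 3 a ^ 2
    rw [A_sq_eq_formula3 𝕜 m hx, A_sq_eq_formula3 𝕜 m ha, h]
    by_cases hne : x ^ 2 - x = t₁ (m + 4)
    · rw [hne]
    · exact (formula3_lt_of_ne m (sq_sub_mem_Icc hx) hne).le

theorem isGreatest_A_image (m : ℕ) :
    IsGreatest (A 𝕜 (m + 4) 3 '' Icc (0 : ℝ) 1) (A 𝕜 (m + 4) 3 (aPlus (t₁ (m + 4)))) := by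
  have hq := (neg_quarter_lt_t₁ m).le
  have h1 : t₁ (m + 4) < 0 := (t₁_lt_t₃ m).trans ((t₃_lt_t₂ m).trans (t₂_neg m))
  have hp : aPlus (t₁ (m + 4)) ∈ Icc (0 : ℝ) 1 :=
    Ioo_subset_Icc_self (mem_Ioo_of_sq_sub_neg (by rw [aPlus_sq_sub hq]; exact h1))
  refine ⟨mem_image_of_mem _ hp, ?_⟩
  rintro _ ⟨x, hx, rfl⟩
  exact (sq_le_sq₀ (A_nonneg 𝕜 _ _ _) (A_nonneg 𝕜 _ _ _)).mp
    ((isMaxOn_A_sq_iff 𝕜 m hp).mpr (aPlus_sq_sub hq) hx)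

theorem Lam_sq_eq (m : ℕ) : Lam 𝕜 (m + 4) 3 ^ 2 = const3 (m + 4) := by
  have hq := (neg_quarter_lt_t₁ m).le
  have h1 : t₁ (m + 4) < 0 := (t₁_lt_t₃ m).trans ((t₃_lt_t₂ m).trans (t₂_neg m))
  have hp : aPlus (t₁ (m + 4)) ∈ Icc (0 : ℝ) 1 :=
    Ioo_subset_Icc_self (mem_Ioo_of_sq_sub_neg (by rw [aPlus_sq_sub hq]; exact h1))
  rw [Lam, (isGreatest_A_image 𝕜 m).csSup_eq, A_sq_eq_formula3 𝕜 m hp, aPlus_sq_sub hq,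
    formula3_t₁]

end SobolevEmbedding

end

/-! ### The theorem assembled. -/

theorem mainTheorem3 (𝕜 : Type*) [RCLike 𝕜] (n : ℕ) (hn : 4 ≤ n) :
    -- the suprema are finite
    (∀ a ∈ Set.Icc (0 : ℝ) 1, BddAbove (SobolevEmbedding.unitBallValues 𝕜 n 3 a)) ∧
    BddAbove (SobolevEmbedding.A 𝕜 n 3 '' Set.Icc (0 : ℝ) 1) ∧
    -- explicit form of the function
    (∀ a ∈ Set.Icc (0 : ℝ) 1,
      SobolevEmbedding.A 𝕜 n 3 a ^ 2 = SobolevEmbedding.formula3 n (a ^ 2 - a)) ∧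
    -- critical points in the open interval, and their nature
    (-(1 / 4) < SobolevEmbedding.t₁ n ∧ SobolevEmbedding.t₁ n < SobolevEmbedding.t₃ n ∧
      SobolevEmbedding.t₃ n < SobolevEmbedding.t₂ n ∧ SobolevEmbedding.t₂ n < 0) ∧
    DifferentiableOn ℝ (fun a => SobolevEmbedding.A 𝕜 n 3 a ^ 2) (Set.Ioo 0 1) ∧
    (∀ a ∈ Set.Ioo (0 : ℝ) 1,
      deriv (fun a => SobolevEmbedding.A 𝕜 n 3 a ^ 2) a = 0 ↔
        a = 1 / 2 ∨ ∃ t ∈ ({SobolevEmbedding.t₁ n, SobolevEmbedding.t₂ n,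
          SobolevEmbedding.t₃ n} : Set ℝ),
            a = SobolevEmbedding.aPlus t ∨ a = SobolevEmbedding.aMinus t) ∧
    (∀ a ∈ ({1 / 2, SobolevEmbedding.aPlus (SobolevEmbedding.t₃ n),
        SobolevEmbedding.aMinus (SobolevEmbedding.t₃ n)} : Set ℝ),
      a ∈ Set.Ioo (0 : ℝ) 1 ∧ IsLocalMin (fun a => SobolevEmbedding.A 𝕜 n 3 a ^ 2) a) ∧
    (∀ a ∈ ({SobolevEmbedding.aPlus (SobolevEmbedding.t₁ n),
        SobolevEmbedding.aMinus (SobolevEmbedding.t₁ n),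
        SobolevEmbedding.aPlus (SobolevEmbedding.t₂ n),
        SobolevEmbedding.aMinus (SobolevEmbedding.t₂ n)} : Set ℝ),
      a ∈ Set.Ioo (0 : ℝ) 1 ∧ IsLocalMax (fun a => SobolevEmbedding.A 𝕜 n 3 a ^ 2) a) ∧
    -- the points of global maximum on the closed interval
    (∀ a ∈ Set.Icc (0 : ℝ) 1,
      IsMaxOn (fun a => SobolevEmbedding.A 𝕜 n 3 a ^ 2) (Set.Icc 0 1) a ↔
        a = SobolevEmbedding.aPlus (SobolevEmbedding.t₁ n) ∨
        a = SobolevEmbedding.aMinus (SobolevEmbedding.t₁ n)) ∧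
    -- the exact embedding constant
    SobolevEmbedding.Lam 𝕜 n 3 ^ 2 = SobolevEmbedding.const3 n := by
  obtain ⟨m, rfl⟩ : ∃ m, n = m + 4 := ⟨n - 4, by omega⟩
  have h01 := SobolevEmbedding.neg_quarter_lt_t₁ m
  have h13 := SobolevEmbedding.t₁_lt_t₃ m
  have h32 := SobolevEmbedding.t₃_lt_t₂ m
  have h20 := SobolevEmbedding.t₂_neg m
  have hmem : ∀ t, -(1 / 4) ≤ t → t < 0 → SobolevEmbedding.aPlus t ∈ Set.Ioo (0 : ℝ) 1 ∧
      SobolevEmbedding.aMinus t ∈ Set.Ioo (0 : ℝ) 1 := fun t ht ht0 =>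
    ⟨SobolevEmbedding.mem_Ioo_of_sq_sub_neg (by rwa [SobolevEmbedding.aPlus_sq_sub ht]),
      SobolevEmbedding.mem_Ioo_of_sq_sub_neg (by rwa [SobolevEmbedding.aMinus_sq_sub ht])⟩
  have hq1 : -(1 / 4) ≤ SobolevEmbedding.t₁ (m + 4) := h01.le
  have hq3 : -(1 / 4) ≤ SobolevEmbedding.t₃ (m + 4) := by linarith
  have hq2 : -(1 / 4) ≤ SobolevEmbedding.t₂ (m + 4) := by linarith
  have hm1 := hmem _ hq1 (by linarith)
  have hm3 := hmem _ hq3 (by linarith)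
  have hm2 := hmem _ hq2 h20
  refine ⟨fun a ha =>
      (SobolevEmbedding.isGreatest_unitBallValues (l := m) (by omega) ha).bddAbove,
    (SobolevEmbedding.isGreatest_A_image 𝕜 m).bddAbove,
    fun a ha => SobolevEmbedding.A_sq_eq_formula3 𝕜 m ha, ⟨h01, h13, h32, h20⟩,
    fun a ha => (SobolevEmbedding.hasDerivAt_A_sq 𝕜 m
      ha).differentiableAt.differentiableWithinAt, ?_, ?_, ?_, ?_,
    SobolevEmbedding.Lam_sq_eq 𝕜 m⟩
  · intro a ha
    -- For m > 0 the slope also vanishes at t = 0, through its factor t²ᵐ; that value occurs only at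
    -- the end points.
    have hne : a ^ 2 - a ≠ 0 := by nlinarith [mul_pos ha.1 (sub_pos.mpr ha.2)]
    rw [(SobolevEmbedding.hasDerivAt_A_sq 𝕜 m ha).deriv, mul_eq_zero,
      SobolevEmbedding.slope3_eq_zero_iff m hne, SobolevEmbedding.sq_sub_eq_iff hq1,
      SobolevEmbedding.sq_sub_eq_iff hq2, SobolevEmbedding.sq_sub_eq_iff hq3,
      show 2 * a - 1 = 0 ↔ a = 1 / 2 by constructor <;> intro h <;> linarith]
    simp only [Set.mem_insert_iff, Set.mem_singleton_iff, exists_eq_or_imp, exists_eq_left]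
    tauto
  · rintro a (rfl | rfl | rfl)
    · exact ⟨by norm_num, SobolevEmbedding.isLocalMin_A_sq_half 𝕜 m⟩
    · refine ⟨hm3.1, SobolevEmbedding.isLocalMin_A_sq 𝕜 m hm3.1 ?_⟩
      rw [SobolevEmbedding.aPlus_sq_sub hq3]
      exact SobolevEmbedding.isLocalMin_formula3_t₃ m
    · refine ⟨hm3.2, SobolevEmbedding.isLocalMin_A_sq 𝕜 m hm3.2 ?_⟩
      rw [SobolevEmbedding.aMinus_sq_sub hq3]
      exact SobolevEmbedding.isLocalMin_formula3_t₃ m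
  · rintro a (rfl | rfl | rfl | rfl)
    · refine ⟨hm1.1, SobolevEmbedding.isLocalMax_A_sq 𝕜 m hm1.1 ?_⟩
      rw [SobolevEmbedding.aPlus_sq_sub hq1]
      exact SobolevEmbedding.isLocalMax_formula3_t₁ m
    · refine ⟨hm1.2, SobolevEmbedding.isLocalMax_A_sq 𝕜 m hm1.2 ?_⟩
      rw [SobolevEmbedding.aMinus_sq_sub hq1]
      exact SobolevEmbedding.isLocalMax_formula3_t₁ m
    · refine ⟨hm2.1, SobolevEmbedding.isLocalMax_A_sq 𝕜 m hm2.1 ?_⟩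
      rw [SobolevEmbedding.aPlus_sq_sub hq2]
      exact SobolevEmbedding.isLocalMax_formula3_t₂ m
    · refine ⟨hm2.2, SobolevEmbedding.isLocalMax_A_sq 𝕜 m hm2.2 ?_⟩
      rw [SobolevEmbedding.aMinus_sq_sub hq2]
      exact SobolevEmbedding.isLocalMax_formula3_t₂ m
  · intro a ha
    rw [SobolevEmbedding.isMaxOn_A_sq_iff 𝕜 m ha, SobolevEmbedding.sq_sub_eq_iff hq1]
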